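/- For complex $\nu$ and $z>0$ let $I_\nu(z)=\sum_{n\ge 0}\frac{(z/2)^{\nu+2n}}{n!\,\Gamma(\nu+n+1)}$ and let $K_\nu(z)=\frac{\pi}{2}\,\frac{I_{-\nu}(z)-I_\nu(z)}{\sin \pi\nu}$ for $\nu\notin\mathbb Z$, with $K_\nu(z)=\lim_{\mu\to\nu}K_\mu(z)$ for $\nu\in\mathbb Z$, be the modified Bessel functions. Let $\zeta(s)$ be the Riemann zeta function and $\zeta(s,\alpha)$ the (analytically continued) Hurwitz zeta function. Let $k\ge 1$ be an odd integer, $a,x>0$ real, and $\nu\in\mathbb C$ with $\Re(\nu)>0$. (i) For every real $\theta$ with $0<\theta<1$, the two series below converge absolutely and $$\left(\frac{a^2x}{4}\right)^{\frac{\nu}{2}+k+1}\sum_{n=1}^{\infty} n^{\nu/2}K_\nu(a\sqrt{nx})\sum_{d\mid n}d^k\cos\left(\frac{2\pi n\theta}{d}\right)=\frac{(-1)^{\frac{k+1}{2}}(2\pi)^{k+1}}{8}\,\Gamma(\nu+k+1)\left\{\zeta(-k,\theta)+\zeta(-k,1-\theta)\right\}$$ $$+\frac{(-1)^{\frac{k+1}{2}}(2\pi)^{k+1}}{4}\,\Gamma(\nu+k+1)\sum_{r=1}^\infty\sum_{m=0}^\infty\left\{\frac{(m+\theta)^k}{\left(\frac{16\pi^2}{a^2}\frac{r(m+\theta)}{x}+1\right)^{\nu+k+1}}+\frac{(m+1-\theta)^k}{\left(\frac{16\pi^2}{a^2}\frac{r(m+1-\theta)}{x}+1\right)^{\nu+k+1}}\right\}-\frac{a^{2k+2}}{2^{2k+4}}\,\zeta(-k)\,\Gamma(\nu)\,x^{k+1}.$$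 (ii) For the given $k,\nu,a,x$, the validity of (i) for all $0<\theta<1$ is equivalent to the following: for every $q\ge1$ and every non-principal even primitive Dirichlet character $\chi$ modulo $q$, the two series below converge absolutely and $$\left(\frac{a^2x}{4}\right)^{\frac{\nu}{2}+k+1}\sum_{n=1}^\infty\bar\sigma_{k,\chi}(n)\,n^{\frac{\nu}{2}}K_\nu(a\sqrt{nx})=\frac{\Gamma(k+1)}{2}\Gamma(\nu+k+1)L(1+k,\chi)+\frac{(-1)^{\frac{k+1}{2}}}{2}\tau(\chi)\left(\frac{2\pi}{q}\right)^{k+1}\sum_{n=1}^\infty\sigma_{k,\bar\chi}(n)\frac{\Gamma(\nu+k+1)}{\left(\frac{16\pi^2}{a^2q}\frac{n}{x}+1\right)^{\nu+k+1}},$$ where $\sigma_{k,\chi}(n)=\sum_{d\mid n}d^k\chi(d)$, $\bar\sigma_{k,\chi}(n)=\sum_{d\mid n}d^k\chi(n/d)$ and $\tau(\chi)=\sum_{h=1}^q\chi(h)e^{2\pi i h/q}$. In particular, since (i) holds, this character identity holds as well. -/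

import Mathlib

open scoped Topology Real

noncomputable section

/-- The modified Bessel function of the first kind (Bessel function of imaginary argument),
`I_ν(z) = ∑_{n ≥ 0} (z/2)^(ν+2n) / (n! Γ(ν+n+1))`, with the principal branch of the power.
Mathlib's `Complex.Gamma` vanishes at the poles of `Γ`, so a term with `ν+n+1` a pole is `0`, which
agrees with the usual convention `1/Γ = 0` there. -/
def besselI (ν z : ℂ) : ℂ :=
  ∑' n : ℕ, (z / 2) ^ (ν + 2 * (n : ℂ)) / ((n.factorial : ℂ) * Complex.Gamma (ν + n + 1))

/-- The quotient `(π/2) (I_{-ν}(z) - I_ν(z)) / sin(πν)`, meaningful for non-integral `ν`. -/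
def besselKQuotient (ν z : ℂ) : ℂ :=
  (π : ℂ) / 2 * ((besselI (-ν) z - besselI ν z) / Complex.sin (π * ν))

open Classical in
/-- The modified Bessel function of the second kind `K_ν(z)`: the quotient above for non-integral
order, and its limit in the order when the order is an integer. -/
def besselK (ν z : ℂ) : ℂ :=
  if ∃ n : ℤ, ν = (n : ℂ) then Filter.limUnder (𝓝[≠] ν) (fun μ : ℂ => besselKQuotient μ z)
  else besselKQuotient ν z

/-- `∑_{d ∣ n} d^k cos(2π n θ / d)`. -/
def cosDivisorSum (k : ℕ) (θ : ℝ) (n : ℕ) : ℝ :=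
  ∑ d ∈ n.divisors, (d : ℝ) ^ k * Real.cos (2 * π * n * θ / d)

/-- `σ_{k,χ}(n) = ∑_{d ∣ n} d^k χ(d)`. -/
def sigmaChi (k : ℕ) {q : ℕ} (χ : DirichletCharacter ℂ q) (n : ℕ) : ℂ :=
  ∑ d ∈ n.divisors, (d : ℂ) ^ k * χ (d : ZMod q)

/-- `σ̄_{k,χ}(n) = ∑_{d ∣ n} d^k χ(n/d)`. -/
def sigmaBarChi (k : ℕ) {q : ℕ} (χ : DirichletCharacter ℂ q) (n : ℕ) : ℂ :=
  ∑ d ∈ n.divisors, (d : ℂ) ^ k * χ ((n / d : ℕ) : ZMod q)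

/-- The summand of the double series:
`t^k / (16π²/a² · r t / x + 1)^(ν+k+1)`, evaluated at `t = m + θ` and `t = m + 1 - θ` and added. -/
def doubleTerm (k : ℕ) (ν : ℂ) (a x θ : ℝ) (r : ℕ+) (m : ℕ) : ℂ :=
  (((m + θ : ℝ) : ℂ) ^ k
      / ((16 * π ^ 2 / a ^ 2 * ((r : ℝ) * (m + θ) / x) + 1 : ℝ) : ℂ) ^ (ν + k + 1))
    + (((m + 1 - θ : ℝ) : ℂ) ^ k
      / ((16 * π ^ 2 / a ^ 2 * ((r : ℝ) * (m + 1 - θ) / x) + 1 : ℝ) : ℂ) ^ (ν + k + 1))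

/-- The trigonometric identity, for the weight `∑_{d ∣ n} d^k cos(2π n θ / d)`, together with the
(absolute) convergence of both series in it. `hurwitzZeta` is the analytically continued Hurwitz
zeta function. -/
def CosIdentity (k : ℕ) (ν : ℂ) (a x θ : ℝ) : Prop :=
  Summable (fun n : ℕ+ =>
    ((n : ℕ) : ℂ) ^ (ν / 2) * besselK ν ((a * √((n : ℝ) * x) : ℝ) : ℂ)
      * (cosDivisorSum k θ n : ℂ)) ∧
  Summable (fun p : ℕ+ × ℕ => doubleTerm k ν a x θ p.1 p.2) ∧
  ((a ^ 2 * x / 4 : ℝ) : ℂ) ^ (ν / 2 + k + 1)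
      * ∑' n : ℕ+, ((n : ℕ) : ℂ) ^ (ν / 2) * besselK ν ((a * √((n : ℝ) * x) : ℝ) : ℂ)
          * (cosDivisorSum k θ n : ℂ)
    = (-1) ^ ((k + 1) / 2) * (2 * (π : ℂ)) ^ (k + 1) / 8 * Complex.Gamma (ν + k + 1)
        * (HurwitzZeta.hurwitzZeta ((θ : ℝ) : UnitAddCircle) (-(k : ℂ))
            + HurwitzZeta.hurwitzZeta ((1 - θ : ℝ) : UnitAddCircle) (-(k : ℂ)))
      + (-1) ^ ((k + 1) / 2) * (2 * (π : ℂ)) ^ (k + 1) / 4 * Complex.Gamma (ν + k + 1)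
        * ∑' r : ℕ+, ∑' m : ℕ, doubleTerm k ν a x θ r m
      - (a : ℂ) ^ (2 * k + 2) / 2 ^ (2 * k + 4) * riemannZeta (-(k : ℂ)) * Complex.Gamma ν
        * (x : ℂ) ^ (k + 1)

/-- The character identity, for the weight `σ̄_{k,χ}(n)`, together with the (absolute) convergence
of both series in it. Here `gaussSum χ ZMod.stdAddChar` is `τ(χ) = ∑_{h mod q} χ(h) e^{2πih/q}` and
`χ⁻¹` is the complex conjugate character. -/
def CharIdentity (k : ℕ) (ν : ℂ) (a x : ℝ) {q : ℕ} [NeZero q] (χ : DirichletCharacter ℂ q) :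
    Prop :=
  Summable (fun n : ℕ+ =>
    sigmaBarChi k χ n * ((n : ℕ) : ℂ) ^ (ν / 2) * besselK ν ((a * √((n : ℝ) * x) : ℝ) : ℂ)) ∧
  Summable (fun n : ℕ+ =>
    sigmaChi k χ⁻¹ n * (Complex.Gamma (ν + k + 1)
      / ((16 * π ^ 2 / (a ^ 2 * q) * ((n : ℝ) / x) + 1 : ℝ) : ℂ) ^ (ν + k + 1))) ∧
  ((a ^ 2 * x / 4 : ℝ) : ℂ) ^ (ν / 2 + k + 1)
      * ∑' n : ℕ+, sigmaBarChi k χ n * ((n : ℕ) : ℂ) ^ (ν / 2)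
          * besselK ν ((a * √((n : ℝ) * x) : ℝ) : ℂ)
    = Complex.Gamma (k + 1) / 2 * Complex.Gamma (ν + k + 1)
        * DirichletCharacter.LFunction χ (1 + k)
      + (-1) ^ ((k + 1) / 2) / 2 * gaussSum χ ZMod.stdAddChar * (2 * (π : ℂ) / q) ^ (k + 1)
        * ∑' n : ℕ+, sigmaChi k χ⁻¹ n * (Complex.Gamma (ν + k + 1)
            / ((16 * π ^ 2 / (a ^ 2 * q) * ((n : ℝ) / x) + 1 : ℝ) : ℂ) ^ (ν + k + 1))

end

/-! The proof is a theta-function style argument: write the Bessel function as an integral, sum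
under the integral sign, and transform the resulting Lambert series by Poisson summation.

Bessel side. For z > 0 and every complex order, K_ν(z) = (z/2)^{-ν}/2 · ∫_0^∞ e^{-z²/(4t)} e^{-t}
t^{ν-1} dt (`besselK_eq_besselInt`), derived from the power series of I_{±ν}. With X = a²x/4 the
powers of n cancel, and the Bessel series with coefficients c_n becomes, up to a power of X, the
integral of e^{-t} t^{ν-1} ∑ c_n e^{-nX/t} (`tsum_besselK`).

Lambert side. For the cosine weight the inner sum is ∑ d^k cos(2πmθ) e^{-dmy} with y = X/t. Poisson
summation is applied to |u|^k/(e^{w|u|} - 1) with w = 4π²/y. Expanding this function geometrically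
gives its Fourier transform as a sum of (rw ± 2πib)^{-k-1}, and at a nonzero integer b Lipschitz's
formula turns that sum back into ∑ d^k e^{-d|b|y} minus its leading singularity. Oddness of k makes
the two signs agree. The result is `lambert_cos_transformation`: a double series of exponentials in
t, a constant, and a multiple of y^{-k-1}.

Integrating against e^{-t} t^{ν-1} term by term with Euler's integral gives `cosIdentity_dirichlet`,
whose constants are ζ(k+1) and ∑ cos(2πmθ)/m^{k+1}. The functional equations of the Riemann and
Hurwitz zeta functions convert them to values at -k, which is (i).

Character side. Averaging the Dirichlet form over θ = h/q with weights χ̄(h) produces Gauss sums: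
cosines become χ(m) times the conjugate of τ(χ), the terms m + h/q reassemble into all integers, and
the term independent of θ disappears because χ̄ sums to 0. The equivalence (ii) then holds because
both of its sides are established. -/

/-! ### Integral representation of K_ν from its definition through I_{±ν}. -/

section BesselIntegral

open MeasureTheory Set Filter

/-- The integrand `e^{-t} t^{s-1}` of Euler's integral, with `s` complex. -/
noncomputable def eulerKernel (s : ℂ) (t : ℝ) : ℂ := (Real.exp (-t) : ℂ) * (t : ℂ) ^ (s - 1)

lemma measurable_eulerKernel (s : ℂ) : Measurable (eulerKernel s) := by
  unfold eulerKernel; fun_prop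

lemma norm_eulerKernel (s : ℂ) {t : ℝ} (ht : 0 < t) :
    ‖eulerKernel s t‖ = Real.exp (-t) * t ^ (s.re - 1) := by
  rw [eulerKernel, norm_mul, Complex.norm_cpow_eq_rpow_re_of_pos ht, Complex.norm_real,
    Real.norm_of_nonneg (Real.exp_pos _).le]
  simp

lemma eulerKernel_mul_cpow (s w : ℂ) {t : ℝ} (ht : 0 < t) :
    eulerKernel s t * (t : ℂ) ^ w = eulerKernel (s + w) t := by
  have : (t : ℂ) ≠ 0 := by exact_mod_cast ht.ne'
  rw [eulerKernel, eulerKernel, mul_assoc, ← Complex.cpow_add _ _ this]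
  ring_nf

lemma integrableOn_eulerKernel {s : ℂ} (hs : 0 < s.re) : IntegrableOn (eulerKernel s) (Ioi 0) :=
  Complex.GammaIntegral_convergent hs

lemma integral_eulerKernel {s : ℂ} (hs : 0 < s.re) :
    ∫ t in Ioi 0, eulerKernel s t = Complex.Gamma s :=
  (Complex.Gamma_eq_integral hs).symm

/-- Away from 0 the order is unrestricted: t^p ≥ c^p on t > c, so raising the order by p costs only
a constant and reduces to the convergent Euler integral. -/
lemma integrableOn_Ioi_eulerKernel {c : ℝ} (hc : 0 < c) (s : ℂ) :
    IntegrableOn (eulerKernel s) (Ioi c) := by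
  obtain ⟨p, hp⟩ := exists_nat_gt (-s.re)
  have h := (integrableOn_eulerKernel (s := s + p) (by simp; linarith)).mono_set
    (Ioi_subset_Ioi hc.le)
  refine Integrable.mono' ((h.norm).const_mul ((c ^ p)⁻¹))
    (measurable_eulerKernel s).aestronglyMeasurable ?_
  refine (ae_restrict_iff' measurableSet_Ioi).2 (Eventually.of_forall fun t ht => ?_)
  have ht0 : 0 < t := hc.trans ht
  rw [norm_eulerKernel _ ht0, norm_eulerKernel _ ht0]
  have : t ^ ((s + p).re - 1) = t ^ (s.re - 1) * t ^ p := by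
    rw [← Real.rpow_natCast, ← Real.rpow_add ht0]
    simp; ring_nf
  rw [this]
  have h1 : 1 ≤ (c ^ p)⁻¹ * t ^ p := by
    rw [inv_mul_eq_div, one_le_div (by positivity)]
    exact pow_le_pow_left₀ hc.le (le_of_lt ht) p
  calc _ = Real.exp (-t) * t ^ (s.re - 1) * 1 := by ring
    _ ≤ Real.exp (-t) * t ^ (s.re - 1) * ((c ^ p)⁻¹ * t ^ p) := by gcongr
    _ = _ := by ring

/-- The upper incomplete gamma function. -/
noncomputable def upperGamma (c : ℝ) (s : ℂ) : ℂ := ∫ t in Ioi c, eulerKernel s t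

/-- Integration by parts, in the form of integrating the derivative of e^{-t} t^s over (c, ∞).
Together with the recurrence of Γ it drives the continuation of the lower incomplete gamma series.
-/
lemma upperGamma_add_one {c : ℝ} (hc : 0 < c) {s : ℂ} (hs : s ≠ 0) :
    upperGamma c (s + 1) = s * upperGamma c s + (Real.exp (-c) : ℂ) * (c : ℂ) ^ s := by
  have hd : ∀ t ∈ Ioi c, HasDerivAt (fun t : ℝ => (Real.exp (-t) : ℂ) * (t : ℂ) ^ s)
      (s * eulerKernel s t - eulerKernel (s + 1) t) t := by
    intro t ht
    have ht0 : 0 < t := hc.trans ht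
    have h1 : HasDerivAt (fun t : ℝ => (Real.exp (-t) : ℂ)) ((-Real.exp (-t) : ℝ) : ℂ) t := by
      have := (Real.hasDerivAt_exp (-t)).comp t (hasDerivAt_neg t)
      simpa using this.ofReal_comp
    have h2 := h1.mul (hasDerivAt_ofReal_cpow_const ht0.ne' hs)
    refine h2.congr_deriv ?_
    simp only [eulerKernel]
    push_cast
    ring_nf
  have hi : IntegrableOn (fun t => s * eulerKernel s t - eulerKernel (s + 1) t) (Ioi c) :=
    ((integrableOn_Ioi_eulerKernel hc s).const_mul s).sub (integrableOn_Ioi_eulerKernel hc _)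
  have hlim : Tendsto (fun t : ℝ => (Real.exp (-t) : ℂ) * (t : ℂ) ^ s) atTop (𝓝 0) := by
    rw [tendsto_zero_iff_norm_tendsto_zero]
    refine (tendsto_rpow_mul_exp_neg_mul_atTop_nhds_zero s.re 1 one_pos).congr' ?_
    filter_upwards [eventually_gt_atTop 0] with t ht
    rw [norm_mul, Complex.norm_cpow_eq_rpow_re_of_pos ht, Complex.norm_real,
      Real.norm_of_nonneg (Real.exp_pos _).le]
    ring_nf
  have hcont : ContinuousWithinAt (fun t : ℝ => (Real.exp (-t) : ℂ) * (t : ℂ) ^ s) (Ici c) c := by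
    refine ContinuousAt.continuousWithinAt (ContinuousAt.mul (by fun_prop) ?_)
    exact (hasDerivAt_ofReal_cpow_const hc.ne' hs).continuousAt
  have := integral_Ioi_of_hasDerivAt_of_tendsto hcont hd hi hlim
  rw [integral_sub ((integrableOn_Ioi_eulerKernel hc s).const_mul s)
    (integrableOn_Ioi_eulerKernel hc _), integral_const_mul] at this
  rw [upperGamma, upperGamma]
  linear_combination -this

/-- Expand e^{-t} in Euler's integral over (0, c] and integrate termwise; the absolute integrals are
dominated by c^m/m! times a constant. -/
lemma hasSum_lowerGamma_of_re_pos {c : ℝ} (hc : 0 < c) {s : ℂ} (hs : 0 < s.re) :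
    HasSum (fun m : ℕ => (-1) ^ m * (c : ℂ) ^ (s + m) / (m.factorial * (s + m)))
      (Complex.Gamma s - upperGamma c s) := by
  have hval : Complex.Gamma s - upperGamma c s = ∫ t in Ioc 0 c, eulerKernel s t := by
    rw [← integral_eulerKernel hs, upperGamma, ← Ioc_union_Ioi_eq_Ioi hc.le,
      setIntegral_union (by simp) measurableSet_Ioi
      ((integrableOn_eulerKernel hs).mono_set Ioc_subset_Ioi_self)
      (integrableOn_Ioi_eulerKernel hc s)]
    ring
  set F : ℕ → ℝ → ℂ := fun m t => (-1) ^ m / m.factorial * (t : ℂ) ^ (s + m - 1) with hF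
  have hre (m : ℕ) : -1 < (s + m - 1).re := by simp; positivity
  have hint (m : ℕ) : IntegrableOn (F m) (Ioc 0 c) := by
    refine Integrable.const_mul ?_ _
    exact (intervalIntegrable_iff_integrableOn_Ioc_of_le hc.le).1
      (intervalIntegral.intervalIntegrable_cpow' (hre m))
  have hFi (m : ℕ) : ∫ t in Ioc 0 c, F m t =
      (-1) ^ m * (c : ℂ) ^ (s + m) / (m.factorial * (s + m)) := by
    have hne : s + m ≠ 0 := fun h => by
      have := congrArg Complex.re h; simp at this; linarith [m.cast_nonneg (α := ℝ)]
    rw [hF, integral_const_mul, ← intervalIntegral.integral_of_le hc.le,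
      integral_cpow (Or.inl (hre m))]
    simp only [sub_add_cancel, Complex.ofReal_zero, Complex.zero_cpow hne]
    have := Nat.cast_ne_zero (R := ℂ).2 m.factorial_ne_zero
    field_simp
    ring
  have hnorm (m : ℕ) : ∫ t in Ioc 0 c, ‖F m t‖ ≤ c ^ m / m.factorial * (c ^ s.re / s.re) := by
    have h1 : ∫ t in Ioc 0 c, ‖F m t‖ ≤
        ∫ t in Ioc 0 c, c ^ m / m.factorial * t ^ (s.re - 1) := by
      refine setIntegral_mono_on (hint m).norm (Integrable.const_mul ?_ _) measurableSet_Ioc ?_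
      · exact (intervalIntegrable_iff_integrableOn_Ioc_of_le hc.le).1
          (intervalIntegral.intervalIntegrable_rpow' (by linarith))
      · intro t ht
        have : t ^ ((s + m - 1).re) = t ^ m * t ^ (s.re - 1) := by
          rw [← Real.rpow_natCast, ← Real.rpow_add ht.1]; simp; ring_nf
        rw [hF]
        simp only [norm_mul, norm_div, norm_pow, norm_neg, norm_one, one_pow, Complex.norm_natCast]
        rw [Complex.norm_cpow_eq_rpow_re_of_pos ht.1, this, ← mul_assoc, one_div_mul_eq_div]
        have := Real.rpow_nonneg ht.1.le (s.re - 1)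
        gcongr
        · exact ht.1.le
        · exact ht.2
    refine h1.trans (le_of_eq ?_)
    rw [integral_const_mul, ← intervalIntegral.integral_of_le hc.le,
      integral_rpow (Or.inl (by linarith))]
    simp [Real.zero_rpow hs.ne']
  have hsum : Summable fun m => ∫ t in Ioc 0 c, ‖F m t‖ :=
    Summable.of_nonneg_of_le (fun m => integral_nonneg fun _ => norm_nonneg _) hnorm
      ((Real.summable_pow_div_factorial c).mul_right _)
  have key := hasSum_integral_of_summable_integral_norm hint hsum
  simp_rw [hFi] at key
  rw [hval]
  suffices h : ∫ t in Ioc 0 c, eulerKernel s t = ∫ t in Ioc 0 c, ∑' m, F m t by rwa [h]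
  refine setIntegral_congr_fun measurableSet_Ioc fun t ht => ?_
  have ht0 : (t : ℂ) ≠ 0 := by exact_mod_cast ht.1.ne'
  have he := NormedSpace.expSeries_div_hasSum_exp (-(t : ℂ))
  rw [← Complex.exp_eq_exp_ℂ] at he
  have := he.mul_right ((t : ℂ) ^ (s - 1))
  rw [eulerKernel, Complex.ofReal_exp, Complex.ofReal_neg, ← this.tsum_eq]
  refine tsum_congr fun m => ?_
  rw [hF]
  simp only
  rw [show s + m - 1 = (s - 1) + m by ring, Complex.cpow_add _ _ ht0, Complex.cpow_natCast,
    neg_pow]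
  ring

/-- The power series of the lower incomplete gamma function, continued to all orders that are not
poles. -/
lemma hasSum_lowerGamma {c : ℝ} (hc : 0 < c) {s : ℂ} (hs : ∀ n : ℕ, s ≠ -n) :
    HasSum (fun m : ℕ => (-1) ^ m * (c : ℂ) ^ (s + m) / (m.factorial * (s + m)))
      (Complex.Gamma s - upperGamma c s) := by
  -- Continuation to the left, one unit strip at a time, by passing from s + 1 to s.
  suffices H : ∀ N : ℕ, ∀ s : ℂ, (∀ n : ℕ, s ≠ -n) → 0 < s.re + N →
      HasSum (fun m : ℕ => (-1) ^ m * (c : ℂ) ^ (s + m) / (m.factorial * (s + m)))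
        (Complex.Gamma s - upperGamma c s) by
    obtain ⟨N, hN⟩ := exists_nat_gt (-s.re)
    exact H N s hs (by linarith)
  intro N
  induction N with
  | zero => intro s _ h; exact hasSum_lowerGamma_of_re_pos hc (by simpa using h)
  | succ N ih =>
    intro s hs h
    have hs0 : s ≠ 0 := by simpa using hs 0
    have hsm (m : ℕ) : s + m ≠ 0 := fun h => hs m (by linear_combination h)
    have h1 := ih (s + 1) (fun n hn => hs (n + 1) (by push_cast; linear_combination hn))
      (by simp; push_cast at h; linarith)
    rw [Complex.Gamma_add_one _ hs0, upperGamma_add_one hc hs0] at h1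
    have he := (NormedSpace.expSeries_div_hasSum_exp (-(c : ℂ))).mul_right ((c : ℂ) ^ s)
    rw [← Complex.exp_eq_exp_ℂ, ← Complex.ofReal_neg, ← Complex.ofReal_exp] at he
    have hc0 : (c : ℂ) ≠ 0 := by exact_mod_cast hc.ne'
    -- If T_m is the m-th term of the series at s, then (s + m)·T_m is a term of c^s e^{-c}, so
    -- s·T_m = a_m + (-c)^m c^s/m!. Moreover a_0 = 0 and a_{m+1} is the m-th term at s + 1.
    set a : ℕ → ℂ := fun m => -(m : ℂ) * ((-1) ^ m * (c : ℂ) ^ (s + m) / (m.factorial * (s + m)))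
      with ha
    have h2 : HasSum a (s * Complex.Gamma s - (s * upperGamma c s
        + (Real.exp (-c) : ℂ) * (c : ℂ) ^ s)) := by
      refine (hasSum_nat_add_iff' 1).1 ?_
      simp only [Finset.range_one, Finset.sum_singleton]
      have hv : s * Complex.Gamma s - (s * upperGamma c s + (Real.exp (-c) : ℂ) * (c : ℂ) ^ s)
          - a 0 = s * Complex.Gamma s - (s * upperGamma c s
            + (Real.exp (-c) : ℂ) * (c : ℂ) ^ s) := by simp [ha]
      rw [hv]
      refine h1.congr_fun fun m => ?_
      have := hsm (m + 1)
      have h3 : (m.factorial : ℂ) ≠ 0 := Nat.cast_ne_zero.2 m.factorial_ne_zero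
      have h4 : (m + 1 : ℂ) ≠ 0 := by exact_mod_cast m.succ_ne_zero
      simp only [ha]
      rw [Nat.factorial_succ, show s + 1 + (m : ℂ) = s + (m + 1 : ℕ) by push_cast; ring]
      push_cast at this ⊢
      field_simp
      ring
    have h6 := (h2.add he).mul_left s⁻¹
    have hv : Complex.Gamma s - upperGamma c s = s⁻¹ * (s * Complex.Gamma s - (s * upperGamma c s
        + (Real.exp (-c) : ℂ) * (c : ℂ) ^ s) + (Real.exp (-c) : ℂ) * (c : ℂ) ^ s) := by
      field_simp
      ring
    rw [hv]
    refine h6.congr_fun fun m => ?_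
    simp only [ha]
    have h3 : (m.factorial : ℂ) ≠ 0 := Nat.cast_ne_zero.2 m.factorial_ne_zero
    have := hsm m
    push_cast
    rw [Complex.cpow_add _ _ hc0, Complex.cpow_natCast, neg_pow (c : ℂ)]
    field_simp
    ring

lemma exp_neg_div_le {c t : ℝ} (hc : 0 < c) (ht : 0 < t) (p : ℕ) :
    Real.exp (-(c / t)) ≤ p.factorial * (c ^ p)⁻¹ * t ^ p := by
  have h := Real.pow_div_factorial_le_exp (c / t) (by positivity) p
  rw [Real.exp_neg]
  calc _ ≤ ((c / t) ^ p / p.factorial)⁻¹ := by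
        apply inv_anti₀ _ h
        positivity
    _ = _ := by rw [div_pow]; field_simp

/-- The integral `∫_0^∞ e^{-c/t} e^{-t} t^{s-1} dt`, equal to `2 c^{s/2} K_s(2√c)`. -/
noncomputable def besselInt (c : ℝ) (s : ℂ) : ℂ :=
  ∫ t in Ioi 0, (Real.exp (-(c / t)) : ℂ) * eulerKernel s t

/-- The free exponent p serves twice: t^p restores integrability at 0 for any order, and c^{-p}
gives arbitrary polynomial decay when c = nX. -/
lemma norm_exp_mul_eulerKernel_le {c : ℝ} (hc : 0 < c) (s : ℂ) (p : ℕ) {t : ℝ} (ht : 0 < t) :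
    ‖(Real.exp (-(c / t)) : ℂ) * eulerKernel s t‖ ≤
      p.factorial * (c ^ p)⁻¹ * (Real.exp (-t) * t ^ (s.re + p - 1)) := by
  rw [norm_mul, Complex.norm_real, Real.norm_of_nonneg (Real.exp_pos _).le,
    norm_eulerKernel _ ht]
  have : t ^ (s.re + p - 1) = t ^ (s.re - 1) * t ^ p := by
    rw [← Real.rpow_natCast, ← Real.rpow_add ht]; ring_nf
  rw [this]
  calc _ ≤ (p.factorial * (c ^ p)⁻¹ * t ^ p) * (Real.exp (-t) * t ^ (s.re - 1)) := by
        gcongr; exact exp_neg_div_le hc ht p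
    _ = _ := by ring

lemma integrableOn_exp_mul_eulerKernel {c : ℝ} (hc : 0 < c) (s : ℂ) :
    IntegrableOn (fun t : ℝ => (Real.exp (-(c / t)) : ℂ) * eulerKernel s t) (Ioi 0) := by
  obtain ⟨p, hp⟩ := exists_nat_gt (-s.re)
  refine Integrable.mono' ((Real.GammaIntegral_convergent (s := s.re + p) (by linarith)).const_mul
    (p.factorial * (c ^ p)⁻¹)) ?_ ?_
  · have := measurable_eulerKernel s
    exact (by fun_prop : Measurable _).aestronglyMeasurable
  · refine (ae_restrict_iff' measurableSet_Ioi).2 (Eventually.of_forall fun t ht => ?_)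
    exact norm_exp_mul_eulerKernel_le hc s p ht

/-- Orders within distance 1 of s are dominated by the sum of the kernels at s + 1 and s - 1.
Continuity in the order is what identifies the limit defining K at integers. -/
lemma continuous_besselInt {c : ℝ} (hc : 0 < c) : Continuous (besselInt c) := by
  rw [continuous_iff_continuousAt]
  intro s
  unfold besselInt
  refine continuousAt_of_dominated (bound := fun t : ℝ =>
    ‖(Real.exp (-(c / t)) : ℂ) * eulerKernel (s + 1) t‖
      + ‖(Real.exp (-(c / t)) : ℂ) * eulerKernel (s - 1) t‖) ?_ ?_ ?_ ?_
  · exact Eventually.of_forall fun w => (integrableOn_exp_mul_eulerKernel hc w).1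
  · filter_upwards [Metric.ball_mem_nhds s one_pos] with w hw
    refine (ae_restrict_iff' measurableSet_Ioi).2 (Eventually.of_forall fun t ht => ?_)
    have ht : 0 < t := ht
    have hre : |w.re - s.re| < 1 := by
      have := Complex.abs_re_le_norm (w - s)
      rw [Metric.mem_ball, dist_eq_norm] at hw
      simpa using this.trans_lt hw
    rw [abs_lt] at hre
    simp only [norm_mul, norm_eulerKernel _ ht, ← mul_add]
    gcongr
    rcases le_total 1 t with h | h
    · have h1 : t ^ (w.re - 1) ≤ t ^ ((s + 1).re - 1) :=
        Real.rpow_le_rpow_of_exponent_le h (by simp; linarith)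
      have h2 := Real.rpow_nonneg ht.le ((s - 1).re - 1)
      linarith
    · have h1 : t ^ (w.re - 1) ≤ t ^ ((s - 1).re - 1) :=
        Real.rpow_le_rpow_of_exponent_ge ht h (by simp; linarith)
      have h2 := Real.rpow_nonneg ht.le ((s + 1).re - 1)
      linarith
  · exact (integrableOn_exp_mul_eulerKernel hc _).norm.add
      (integrableOn_exp_mul_eulerKernel hc _).norm
  · refine (ae_restrict_iff' measurableSet_Ioi).2 (Eventually.of_forall fun t ht => ?_)
    have ht0 : (t : ℂ) ≠ 0 := by exact_mod_cast (ne_of_gt ht)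
    unfold eulerKernel
    refine ContinuousAt.mul continuousAt_const (ContinuousAt.mul continuousAt_const ?_)
    exact (continuousAt_const_cpow ht0).comp (by fun_prop)

lemma hasSum_exp_mul_eulerKernel {b : ℝ} (hb : 0 < b) {c : ℝ} (hc : 0 < c) (s : ℂ) :
    HasSum (fun n : ℕ => (-(c : ℂ)) ^ n / n.factorial * upperGamma b (s - n))
      (∫ t in Ioi b, (Real.exp (-(c / t)) : ℂ) * eulerKernel s t) := by
  set F : ℕ → ℝ → ℂ := fun n t => (-(c : ℂ)) ^ n / n.factorial * eulerKernel (s - n) t with hF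
  have hint (n : ℕ) : IntegrableOn (F n) (Ioi b) :=
    (integrableOn_Ioi_eulerKernel hb _).const_mul _
  have hker (n : ℕ) {t : ℝ} (ht : 0 < t) :
      eulerKernel (s - n) t = eulerKernel s t * ((t : ℂ)⁻¹) ^ n := by
    rw [sub_eq_add_neg, ← eulerKernel_mul_cpow s _ ht, Complex.cpow_neg, Complex.cpow_natCast,
      inv_pow]
  have hnorm (n : ℕ) : ∫ t in Ioi b, ‖F n t‖ ≤
      (c / b) ^ n / n.factorial * ∫ t in Ioi b, ‖eulerKernel s t‖ := by
    rw [← integral_const_mul]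
    refine setIntegral_mono_on (hint n).norm
      ((integrableOn_Ioi_eulerKernel hb _).norm.const_mul _) measurableSet_Ioi fun t ht => ?_
    have ht : b < t := ht
    have ht0 : 0 < t := hb.trans ht
    rw [hF]
    simp only [hker n ht0, norm_mul, norm_div, norm_pow, norm_neg, norm_inv, Complex.norm_natCast,
      Complex.norm_real, Real.norm_of_nonneg hc.le, Real.norm_of_nonneg ht0.le]
    have : (t⁻¹) ^ n ≤ (b⁻¹) ^ n := pow_le_pow_left₀ (by positivity) (inv_anti₀ hb ht.le) n
    calc _ = c ^ n / n.factorial * ‖eulerKernel s t‖ * (t⁻¹) ^ n := by ring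
      _ ≤ c ^ n / n.factorial * ‖eulerKernel s t‖ * (b⁻¹) ^ n := by gcongr
      _ = _ := by rw [div_eq_mul_inv c b, mul_pow]; ring
  have hsum : Summable fun m => ∫ t in Ioi b, ‖F m t‖ :=
    Summable.of_nonneg_of_le (fun m => integral_nonneg fun _ => norm_nonneg _) hnorm
      ((Real.summable_pow_div_factorial _).mul_right _)
  have key := hasSum_integral_of_summable_integral_norm hint hsum
  have h : ∫ t in Ioi b, (Real.exp (-(c / t)) : ℂ) * eulerKernel s t
      = ∫ t in Ioi b, ∑' m, F m t := by
    refine setIntegral_congr_fun measurableSet_Ioi fun t ht => ?_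
    have ht0 : 0 < t := hb.trans ht
    have he := (NormedSpace.expSeries_div_hasSum_exp (-((c : ℂ) / t))).mul_right (eulerKernel s t)
    rw [← Complex.exp_eq_exp_ℂ] at he
    have h2 : (Real.exp (-(c / t)) : ℂ) * eulerKernel s t
      = Complex.exp (-((c : ℂ) / t)) * eulerKernel s t := by push_cast; rfl
    simp only [h2]
    rw [← he.tsum_eq]
    refine tsum_congr fun n => ?_
    rw [hF]
    simp only [hker n ht0]
    rw [← neg_div, div_eq_mul_inv (-(c : ℂ)), mul_pow]
    ring
  rw [h]
  refine key.congr_fun fun n => ?_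
  rw [hF, integral_const_mul, upperGamma]

/-- The substitution t = c/u exchanges e^{-c/t} with e^{-t} and carries (0, 1) to (c, ∞). Both
pieces then stay away from 0, where e^{-c/t} can be expanded in powers of 1/t. -/
lemma besselInt_split {c : ℝ} (hc : 0 < c) (s : ℂ) :
    besselInt c s = (∫ t in Ioi (1 : ℝ), (Real.exp (-(c / t)) : ℂ) * eulerKernel s t)
      + (c : ℂ) ^ s * ∫ t in Ioi c, (Real.exp (-(c / t)) : ℂ) * eulerKernel (-s) t := by
  have hi := integrableOn_exp_mul_eulerKernel hc s
  have himg : (fun u : ℝ => c / u) '' (Ioi c) = Ioo 0 1 := by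
    ext t
    simp only [mem_image, mem_Ioi, mem_Ioo]
    constructor
    · rintro ⟨u, hu, rfl⟩
      have : 0 < u := hc.trans hu
      exact ⟨by positivity, (div_lt_one this).2 hu⟩
    · rintro ⟨h0, h1⟩
      exact ⟨c / t, by rw [lt_div_iff₀ h0]; nlinarith, by field_simp⟩
  have hsub := integral_image_eq_integral_abs_deriv_smul (s := Ioi c) (f := fun u : ℝ => c / u)
    (f' := fun u => -(c / u ^ 2)) measurableSet_Ioi (fun u hu => by
      have hu0 : u ≠ 0 := (hc.trans hu).ne'
      have := (hasDerivAt_inv hu0).const_mul c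
      simp only [← div_eq_mul_inv] at this
      exact (this.congr_deriv (by field_simp)).hasDerivWithinAt) (fun u hu v hv h => by
      have hu0 : u ≠ 0 := (hc.trans hu).ne'
      have hv0 : v ≠ 0 := (hc.trans hv).ne'
      simp only at h
      field_simp at h
      exact h.symm) (fun t => (Real.exp (-(c / t)) : ℂ) * eulerKernel s t)
  rw [himg] at hsub
  rw [besselInt, ← Ioc_union_Ioi_eq_Ioi zero_le_one, setIntegral_union (by simp) measurableSet_Ioi
      (hi.mono_set Ioc_subset_Ioi_self) (hi.mono_set (Ioi_subset_Ioi zero_le_one)), add_comm,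
    integral_Ioc_eq_integral_Ioo, hsub, ← integral_const_mul]
  congr 1
  refine setIntegral_congr_fun measurableSet_Ioi fun u hu => ?_
  have hu : 0 < u := hc.trans hu
  have hu0 : (u : ℂ) ≠ 0 := by exact_mod_cast hu.ne'
  have hc0 : (c : ℂ) ≠ 0 := by exact_mod_cast hc.ne'
  simp only [eulerKernel, abs_neg]
  rw [abs_of_pos (by positivity), div_div_cancel₀ hc.ne', Complex.real_smul]
  have h1 : ((c / u : ℝ) : ℂ) ^ (s - 1) = (c : ℂ) ^ s * (c : ℂ)⁻¹ * ((u : ℂ) ^ (-s - 1) * u ^ 2) := by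
    rw [div_eq_mul_inv, Complex.ofReal_mul, Complex.mul_cpow_ofReal_nonneg hc.le
      (by positivity), Complex.cpow_sub _ _ hc0, Complex.cpow_one, Complex.ofReal_inv,
      Complex.inv_cpow _ _ (by rw [Complex.arg_ofReal_of_nonneg hu.le]; exact Real.pi_pos.ne),
      ← Complex.cpow_neg, show -(s - 1) = (-s - 1) + (2 : ℕ) by push_cast; ring,
      Complex.cpow_add _ _ hu0, Complex.cpow_natCast, ← div_eq_mul_inv]
  rw [h1]
  push_cast
  field_simp

lemma exists_pos_le_norm_sub_intCast {s : ℂ} (hs : ¬ ∃ n : ℤ, s = n) :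
    ∃ δ > 0, ∀ n : ℤ, δ ≤ ‖s - n‖ := by
  have hne : (Set.range (Int.cast : ℤ → ℂ)).Nonempty := Set.range_nonempty _
  have hmem : s ∉ Set.range (Int.cast : ℤ → ℂ) := fun ⟨n, hn⟩ => hs ⟨n, hn.symm⟩
  refine ⟨Metric.infDist s (Set.range (Int.cast : ℤ → ℂ)),
    (Complex.isClosed_range_intCast.notMem_iff_infDist_pos hne).1 hmem, fun n => ?_⟩
  rw [← dist_eq_norm]
  exact Metric.infDist_le_dist_of_mem (Set.mem_range_self n)

/-- The reflection formula turns Γ(s - n) into the reciprocal gamma factors of I_{-s}; the shift by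
n contributes the sign that cancels (-1)^n. -/
lemma neg_pow_mul_Gamma_sub {s : ℂ} (hs : ¬ ∃ n : ℤ, s = n) (c : ℂ) (n : ℕ) :
    (-c) ^ n / n.factorial * Complex.Gamma (s - n)
      = π / Complex.sin (π * s) * (c ^ n / (n.factorial * Complex.Gamma (-s + n + 1))) := by
  have hg : Complex.Gamma (-s + n + 1) ≠ 0 := by
    refine Complex.Gamma_ne_zero fun m hm => hs ⟨n + 1 + m, ?_⟩
    push_cast; linear_combination -hm
  have h := Complex.Gamma_mul_Gamma_one_sub (s - n)
  rw [show 1 - (s - n) = -s + n + 1 by ring, show (π : ℂ) * (s - n) = π * s - n * π by ring,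
    Complex.sin_antiperiodic.sub_nat_mul_eq] at h
  have h2 : Complex.Gamma (s - n)
      = π / ((-1) ^ n * Complex.sin (π * s)) / Complex.Gamma (-s + n + 1) := by
    rw [← h]; field_simp
  have h3 : ((-1 : ℂ) ^ n)⁻¹ = (-1) ^ n := by rw [← inv_pow]; norm_num
  rw [h2, neg_pow c, div_mul_eq_div_div, div_eq_mul_inv (π : ℂ) ((-1) ^ n), h3]
  have h4 : (-1 : ℂ) ^ n * (-1) ^ n = 1 := by rw [← mul_pow]; norm_num
  linear_combination (c ^ n / n.factorial * π / Complex.sin (π * s) /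
    Complex.Gamma (-s + n + 1)) * h4

/-- The two power series of `besselInt`, up to a constant that cancels in their sum. -/
lemma exists_hasSum_besselInt {c : ℝ} (hc : 0 < c) {s : ℂ} (hs : ¬ ∃ n : ℤ, s = n) :
    ∃ A B : ℂ, A + B = besselInt c s ∧
      HasSum (fun n : ℕ => (-(c : ℂ)) ^ n / n.factorial * Complex.Gamma (s - n)) A ∧
      HasSum (fun n : ℕ => (c : ℂ) ^ s *
        ((-(c : ℂ)) ^ n / n.factorial * Complex.Gamma (-s - n))) B := by
  obtain ⟨δ, hδ, hδs⟩ := exists_pos_le_norm_sub_intCast hs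
  have hc0 : (c : ℂ) ≠ 0 := by exact_mod_cast hc.ne'
  -- Replacing each upper incomplete gamma by Γ minus its lower series leaves a double series in
  -- each piece of the split integral. Up to sign and transposition of indices it is the same series
  -- D, so the two corrections cancel in A + B. Its absolute convergence uses that s stays at
  -- distance δ from the integers.
  set D : ℕ × ℕ → ℂ := fun p =>
    (-(c : ℂ)) ^ p.1 / p.1.factorial * ((-1) ^ p.2 / (p.2.factorial * (s - p.1 + p.2))) with hD
  have hDs : Summable D := by
    have h1 : Summable fun p : ℕ × ℕ => (c ^ p.1 / p.1.factorial) * (1 ^ p.2 / p.2.factorial) :=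
      (Real.summable_pow_div_factorial c).mul_of_nonneg (Real.summable_pow_div_factorial 1)
        (fun n => by positivity) (fun n => by positivity)
    refine Summable.of_norm_bounded (h1.mul_right δ⁻¹) fun p => ?_
    have hp : δ ≤ ‖s - p.1 + p.2‖ := by
      have := hδs ((p.1 : ℤ) - p.2)
      push_cast at this
      rwa [← sub_add] at this
    rw [hD]
    simp only [norm_mul, norm_div, norm_pow, norm_neg, norm_one, Complex.norm_natCast,
      Complex.norm_real, Real.norm_of_nonneg hc.le]
    rw [mul_assoc, div_mul_eq_div_div _ (p.2.factorial : ℝ), div_eq_mul_inv _ ‖s - p.1 + p.2‖]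
    gcongr
  have hDs' : Summable fun p : ℕ × ℕ => -D p.swap :=
    ((Equiv.prodComm ℕ ℕ).summable_iff.2 hDs).neg
  have h1 (n : ℕ) : HasSum (fun m => D (n, m))
      ((-(c : ℂ)) ^ n / n.factorial * (Complex.Gamma (s - n) - upperGamma 1 (s - n))) := by
    have := (hasSum_lowerGamma one_pos (s := s - n) (fun m hm => hs ⟨n - m, by
      push_cast; linear_combination hm⟩)).mul_left ((-(c : ℂ)) ^ n / n.factorial)
    refine this.congr_fun fun m => ?_
    simp [hD]
  have h2 (n : ℕ) : HasSum (fun m => -D (m, n)) ((c : ℂ) ^ s *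
      ((-(c : ℂ)) ^ n / n.factorial * (Complex.Gamma (-s - n) - upperGamma c (-s - n)))) := by
    have := ((hasSum_lowerGamma hc (s := -s - n) (fun m hm => hs ⟨m - n, by
      push_cast; linear_combination -hm⟩)).mul_left ((-(c : ℂ)) ^ n / n.factorial)).mul_left
        ((c : ℂ) ^ s)
    refine this.congr_fun fun m => ?_
    have hne : s - m + n ≠ 0 := fun h => hs ⟨m - n, by push_cast; linear_combination h⟩
    have hne' : -s - n + m ≠ 0 := fun h => hne (by linear_combination -h)
    have h3 : (m.factorial : ℂ) ≠ 0 := Nat.cast_ne_zero.2 m.factorial_ne_zero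
    have h4 : (n.factorial : ℂ) ≠ 0 := Nat.cast_ne_zero.2 n.factorial_ne_zero
    have h5 : (c : ℂ) ^ (-s - n + m) = ((c : ℂ) ^ s)⁻¹ * ((c : ℂ) ^ n)⁻¹ * (c : ℂ) ^ m := by
      rw [Complex.cpow_add _ _ hc0, Complex.cpow_sub _ _ hc0, Complex.cpow_neg,
        Complex.cpow_natCast, Complex.cpow_natCast, div_eq_mul_inv]
    have h6 : (c : ℂ) ^ s ≠ 0 := by simp [Complex.cpow_eq_zero_iff, hc0]
    simp only [hD, h5]
    rw [neg_pow (c : ℂ), neg_pow (c : ℂ), show -s - n + m = -(s - m + n) by ring]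
    field_simp
  have H1 := (hDs.hasSum.prod_fiberwise h1).add (hasSum_exp_mul_eulerKernel one_pos hc s)
  have H2 := (hDs'.hasSum.prod_fiberwise h2).add
    ((hasSum_exp_mul_eulerKernel hc hc (-s)).mul_left ((c : ℂ) ^ s))
  refine ⟨_, _, ?_, H1.congr_fun fun n => by ring, H2.congr_fun fun n => by ring⟩
  have h3 : ∑' p : ℕ × ℕ, -D p.swap = -∑' p, D p := by
    rw [tsum_neg]
    congr 1
    exact (Equiv.prodComm ℕ ℕ).tsum_eq D
  rw [h3, besselInt_split hc]
  ring

lemma hasSum_besselI_of {z : ℝ} (hz : 0 < z) {s A : ℂ}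
    (h : HasSum (fun n : ℕ => (((z / 2) ^ 2 : ℝ) : ℂ) ^ n
      / (n.factorial * Complex.Gamma (s + n + 1))) A) :
    besselI s z = ((z / 2 : ℝ) : ℂ) ^ s * A := by
  have hz0 : ((z / 2 : ℝ) : ℂ) ≠ 0 := by exact_mod_cast (half_pos hz).ne'
  rw [besselI, ← (h.mul_left _).tsum_eq]
  refine tsum_congr fun n => ?_
  rw [show (z : ℂ) / 2 = ((z / 2 : ℝ) : ℂ) by push_cast; rfl, Complex.cpow_add _ _ hz0,
    show (2 : ℂ) * n = ((2 * n : ℕ) : ℂ) by push_cast; rfl, Complex.cpow_natCast, pow_mul,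
    Complex.ofReal_pow]
  ring

lemma besselKQuotient_eq {z : ℝ} (hz : 0 < z) {s : ℂ} (hs : ¬ ∃ n : ℤ, s = n) :
    besselKQuotient s z = ((z / 2 : ℝ) : ℂ) ^ (-s) / 2 * besselInt ((z / 2) ^ 2) s := by
  have hz2 := half_pos hz
  have hz0 : ((z / 2 : ℝ) : ℂ) ≠ 0 := by exact_mod_cast hz2.ne'
  have hsin : Complex.sin (π * s) ≠ 0 := by
    rw [Complex.sin_ne_zero_iff]
    intro k hk
    have : (π : ℂ) ≠ 0 := by exact_mod_cast Real.pi_ne_zero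
    exact hs ⟨k, mul_left_cancel₀ this (by rw [hk]; ring)⟩
  have hpi : (π : ℂ) ≠ 0 := by exact_mod_cast Real.pi_ne_zero
  have hs' : ¬ ∃ n : ℤ, -s = n := fun ⟨n, hn⟩ => hs ⟨-n, by push_cast; rw [← hn, neg_neg]⟩
  obtain ⟨A, B, hAB, hA, hB⟩ := exists_hasSum_besselInt (pow_pos hz2 2) hs
  have hcs : (((z / 2) ^ 2 : ℝ) : ℂ) ^ s = ((z / 2 : ℝ) : ℂ) ^ s * ((z / 2 : ℝ) : ℂ) ^ s := by
    rw [sq, Complex.ofReal_mul, Complex.mul_cpow_ofReal_nonneg hz2.le hz2.le]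
  have hzs : ((z / 2 : ℝ) : ℂ) ^ s ≠ 0 := fun h => hz0 ((Complex.cpow_eq_zero_iff _ _).1 h).1
  have hS : Complex.sin (π * s) / π * (π / Complex.sin (π * s)) = 1 :=
    div_mul_div_cancel₀' hsin _ _ |>.trans (div_self hpi)
  have h1 := hasSum_besselI_of (s := -s) hz (A := Complex.sin (π * s) / π * A)
    ((hA.mul_left (Complex.sin (π * s) / π)).congr_fun fun n => by
      rw [neg_pow_mul_Gamma_sub hs, ← mul_assoc, hS, one_mul])
  have h2 := hasSum_besselI_of (s := s) hz
    (A := -(Complex.sin (π * s) / π) * ((((z / 2) ^ 2 : ℝ) : ℂ) ^ s)⁻¹ * B)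
    ((hB.mul_left (-(Complex.sin (π * s) / π) * ((((z / 2) ^ 2 : ℝ) : ℂ) ^ s)⁻¹)).congr_fun
      fun n => by
        have hne : (((z / 2) ^ 2 : ℝ) : ℂ) ^ s ≠ 0 := by rw [hcs]; exact mul_ne_zero hzs hzs
        rw [neg_pow_mul_Gamma_sub hs', mul_neg (π : ℂ) s, Complex.sin_neg, neg_neg, div_neg,
          mul_assoc, inv_mul_cancel_left₀ hne, ← mul_assoc, neg_mul_neg, hS, one_mul])
  rw [besselKQuotient, h1, h2, ← hAB, hcs, Complex.cpow_neg]
  field_simp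
  ring

/-- The integral representation of `K_s(z)`, for every complex order. -/
theorem besselK_eq_besselInt {z : ℝ} (hz : 0 < z) (s : ℂ) :
    besselK s z = ((z / 2 : ℝ) : ℂ) ^ (-s) / 2 * besselInt ((z / 2) ^ 2) s := by
  rw [besselK]
  split_ifs with h
  · refine Filter.Tendsto.limUnder_eq ?_
    have hz2 := half_pos hz
    have hz0 : ((z / 2 : ℝ) : ℂ) ≠ 0 := by exact_mod_cast hz2.ne'
    have hcont : Continuous fun w : ℂ =>
        ((z / 2 : ℝ) : ℂ) ^ (-w) / 2 * besselInt ((z / 2) ^ 2) w := by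
      refine Continuous.mul (Continuous.div_const ?_ _) (continuous_besselInt (pow_pos hz2 2))
      exact continuous_neg.const_cpow (Or.inl hz0)
    refine ((hcont.tendsto s).mono_left nhdsWithin_le_nhds).congr' ?_
    obtain ⟨n, rfl⟩ := h
    rw [EventuallyEq, eventually_nhdsWithin_iff]
    -- The punctured unit disc around n contains no integer, so the quotient formula applies
    -- throughout it.
    filter_upwards [Metric.ball_mem_nhds (n : ℂ) one_pos] with w hw hne
    refine (besselKQuotient_eq hz ?_).symm
    rintro ⟨m, rfl⟩
    rw [Metric.mem_ball, Complex.dist_eq] at hw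
    have h1 : |m - n| < 1 := by
      have : ‖((m - n : ℤ) : ℂ)‖ < 1 := by push_cast; exact hw
      rw [Complex.norm_intCast] at this
      exact_mod_cast this
    have h2 : m = n := by rw [abs_lt] at h1; omega
    exact hne (by rw [h2]; rfl)
  · exact besselKQuotient_eq hz h

end BesselIntegral

/-! ### Poisson summation and the transformation of the cosine Lambert series. -/

section PeriodizedPoissonSum

open MeasureTheory Set Filter

lemma integrableOn_pow_mul_cexp {c : ℂ} (hc : 0 < c.re) (k : ℕ) :
    IntegrableOn (fun u : ℝ => (u : ℂ) ^ k * Complex.exp (-c * u)) (Ioi 0) := by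
  have h := integrableOn_rpow_mul_exp_neg_mul_rpow (s := k) (p := 1) (b := c.re)
    (by linarith [k.cast_nonneg (α := ℝ)]) one_pos hc
  refine Integrable.mono' h (by fun_prop : Continuous _).aestronglyMeasurable ?_
  refine (ae_restrict_iff' measurableSet_Ioi).2 (Eventually.of_forall fun u hu => le_of_eq ?_)
  have hu : 0 < u := hu
  simp [Complex.norm_exp, abs_of_pos hu]

lemma integral_pow_mul_cexp {c : ℂ} (hc : 0 < c.re) (k : ℕ) :
    ∫ u in Ioi (0 : ℝ), (u : ℂ) ^ k * Complex.exp (-c * u) = k.factorial / c ^ (k + 1) := by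
  have hc0 : c ≠ 0 := by rintro rfl; simp at hc
  induction k with
  | zero =>
    have := integral_exp_mul_complex_Ioi (a := -c) (by simpa using hc) 0
    simpa using this
  | succ k ih =>
    have hd : ∀ u ∈ Ioi (0 : ℝ), HasDerivAt
        (fun u : ℝ => (u : ℂ) ^ (k + 1) * Complex.exp (-c * u))
        ((k + 1) * ((u : ℂ) ^ k * Complex.exp (-c * u))
          - c * ((u : ℂ) ^ (k + 1) * Complex.exp (-c * u))) u := by
      intro u _
      have h1 : HasDerivAt (fun z : ℂ => z ^ (k + 1) * Complex.exp (-c * z))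
          ((k + 1) * ((u : ℂ) ^ k * Complex.exp (-c * u))
          - c * ((u : ℂ) ^ (k + 1) * Complex.exp (-c * u))) (u : ℂ) := by
        have h2 := (hasDerivAt_pow (k + 1) (u : ℂ)).mul
          (((hasDerivAt_id (u : ℂ)).const_mul (-c)).cexp)
        refine h2.congr_deriv ?_
        simp
        ring
      exact h1.comp_ofReal
    have hi1 := (integrableOn_pow_mul_cexp hc k).const_mul (k + 1 : ℂ)
    have hi2 := (integrableOn_pow_mul_cexp hc (k + 1)).const_mul c
    have hlim : Tendsto (fun u : ℝ => (u : ℂ) ^ (k + 1) * Complex.exp (-c * u)) atTop (𝓝 0) := by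
      rw [tendsto_zero_iff_norm_tendsto_zero]
      refine (tendsto_rpow_mul_exp_neg_mul_atTop_nhds_zero (k + 1 : ℕ) _ hc).congr' ?_
      filter_upwards [eventually_gt_atTop 0] with u hu
      rw [norm_mul, norm_pow, Complex.norm_real, Real.norm_of_nonneg hu.le, Complex.norm_exp,
        Real.rpow_natCast]
      simp
    have := integral_Ioi_of_hasDerivAt_of_tendsto (by fun_prop) hd (hi1.sub hi2) hlim
    rw [integral_sub hi1 hi2, integral_const_mul, integral_const_mul, ih] at this
    simp only [Complex.ofReal_zero, ne_eq, Nat.add_eq_zero_iff, one_ne_zero, and_false,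
      not_false_eq_true, zero_pow, zero_mul, sub_zero] at this
    rw [eq_div_iff (pow_ne_zero _ hc0), Nat.factorial_succ]
    rw [sub_eq_zero, mul_div_assoc', eq_comm, eq_div_iff (pow_ne_zero _ hc0)] at this
    push_cast
    linear_combination this

/-- The even function `|u|^k e^{-a|u|}`. -/
noncomputable def absPowExp (k : ℕ) (a u : ℝ) : ℝ := |u| ^ k * Real.exp (-a * |u|)

/-- Splitting at 0 and reflecting the negative half-line leaves two Laplace integrals of u^k, at a +
bi and a - bi. -/
lemma integrable_absPowExp_mul_cexp {a : ℝ} (ha : 0 < a) (k : ℕ) (b : ℝ) :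
    Integrable (fun u : ℝ => (absPowExp k a u : ℂ) * Complex.exp (-(b * Complex.I) * u)) ∧
    ∫ u : ℝ, (absPowExp k a u : ℂ) * Complex.exp (-(b * Complex.I) * u)
      = k.factorial / (a + b * Complex.I) ^ (k + 1)
        + k.factorial / (a - b * Complex.I) ^ (k + 1) := by
  set f : ℝ → ℂ := fun u => (absPowExp k a u : ℂ) * Complex.exp (-(b * Complex.I) * u) with hf
  have h1 : EqOn f (fun u : ℝ => (u : ℂ) ^ k * Complex.exp (-(a + b * Complex.I) * u))
      (Ioi 0) := by
    intro u hu
    have hu : 0 < u := hu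
    simp only [hf, absPowExp, abs_of_pos hu]
    push_cast
    rw [mul_assoc, ← Complex.exp_add]
    ring_nf
  have h2 : EqOn (fun u => f (-u))
      (fun u : ℝ => (u : ℂ) ^ k * Complex.exp (-(a - b * Complex.I) * u)) (Ioi 0) := by
    intro u hu
    have hu : 0 < u := hu
    simp only [hf, absPowExp, abs_neg, abs_of_pos hu]
    push_cast
    rw [mul_assoc, ← Complex.exp_add]
    ring_nf
  have hre1 : 0 < ((a : ℂ) + b * Complex.I).re := by simpa using ha
  have hre2 : 0 < ((a : ℂ) - b * Complex.I).re := by simpa using ha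
  have hi1 : IntegrableOn f (Ioi 0) :=
    (integrableOn_congr_fun h1 measurableSet_Ioi).2 (integrableOn_pow_mul_cexp hre1 k)
  have hi2 : IntegrableOn f (Iic 0) := by
    rw [integrableOn_Iic_iff_integrableOn_Iio]
    have h3 : IntegrableOn (fun u => f (-u)) (Ioi 0) :=
      (integrableOn_congr_fun h2 measurableSet_Ioi).2 (integrableOn_pow_mul_cexp hre2 k)
    simpa using h3.comp_neg
  refine ⟨?_, ?_⟩
  · rw [← integrableOn_univ, ← Iic_union_Ioi (a := (0 : ℝ))]
    exact hi2.union hi1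
  · have h3 := integral_comp_neg_Ioi 0 f
    rw [neg_zero] at h3
    rw [← intervalIntegral.integral_Iic_add_Ioi hi2 hi1, ← h3,
      setIntegral_congr_fun measurableSet_Ioi h1, setIntegral_congr_fun measurableSet_Ioi h2,
      integral_pow_mul_cexp hre1, integral_pow_mul_cexp hre2, add_comm]

lemma integral_absPowExp {a : ℝ} (ha : 0 < a) (k : ℕ) :
    Integrable (absPowExp k a) ∧ ∫ u : ℝ, absPowExp k a u = 2 * k.factorial / a ^ (k + 1) := by
  obtain ⟨h1, h2⟩ := integrable_absPowExp_mul_cexp ha k 0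
  simp only [Complex.ofReal_zero, zero_mul, neg_zero, Complex.exp_zero, mul_one, add_zero,
    sub_zero] at h1 h2
  refine ⟨by simpa using h1.re, ?_⟩
  rw [integral_complex_ofReal] at h2
  have h3 : ((∫ u : ℝ, absPowExp k a u : ℝ) : ℂ) = ((2 * k.factorial / a ^ (k + 1) : ℝ) : ℂ) := by
    rw [h2]; push_cast; ring
  exact_mod_cast h3

/-- The function `|u|^k / (e^{w|u|} - 1)`, extended continuously to `u = 0`. -/
noncomputable def bose (k : ℕ) (w u : ℝ) : ℝ :=
  |u| ^ (k - 1) * (dslope (fun s => Real.exp (w * s)) 0 |u|)⁻¹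

lemma bose_of_ne_zero {k : ℕ} (hk : 1 ≤ k) (w : ℝ) {u : ℝ} (hu : u ≠ 0) :
    bose k w u = |u| ^ k / (Real.exp (w * |u|) - 1) := by
  have h := abs_pos.2 hu
  rw [bose, dslope_of_ne _ h.ne', slope_def_field]
  obtain ⟨j, rfl⟩ := Nat.exists_eq_add_of_le' hk
  simp only [add_tsub_cancel_right, mul_zero, Real.exp_zero, sub_zero, inv_div]
  rw [pow_succ, mul_div_assoc]

/-- The slope of e^{ws} at 0 extends continuously by w ≠ 0, so its reciprocal causes no singularity;
Poisson summation needs continuity at 0 as well. -/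
lemma continuous_bose {k : ℕ} {w : ℝ} (hw : 0 < w) : Continuous (bose k w) := by
  have hd : Continuous (dslope (fun s => Real.exp (w * s)) 0) := by
    rw [← continuousOn_univ, continuousOn_dslope univ_mem]
    exact ⟨by fun_prop, by fun_prop⟩
  have hne (u : ℝ) : dslope (fun s => Real.exp (w * s)) 0 |u| ≠ 0 := by
    rcases eq_or_ne u 0 with rfl | hu
    · rw [abs_zero, dslope_same]
      have : HasDerivAt (fun s => Real.exp (w * s)) w 0 := by
        have := ((hasDerivAt_id (0 : ℝ)).const_mul w).exp
        simpa using this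
      rw [this.deriv]
      exact hw.ne'
    · have h := abs_pos.2 hu
      rw [dslope_of_ne _ h.ne', slope_def_field]
      have h1 : 1 < Real.exp (w * |u|) := Real.one_lt_exp_iff.2 (by positivity)
      refine div_ne_zero ?_ (by simpa using hu)
      rw [mul_zero, Real.exp_zero]
      linarith
  exact (continuous_abs.pow _).mul ((hd.comp continuous_abs).inv₀ hne)

lemma one_add_pow_div_factorial_le_exp {x : ℝ} (hx : 0 ≤ x) {n : ℕ} (hn : 1 ≤ n) :
    1 + x ^ n / n.factorial ≤ Real.exp x := by
  refine le_trans ?_ (Real.sum_le_exp_of_nonneg hx (n + 1))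
  rw [Finset.sum_range_succ]
  gcongr
  have : (1 : ℝ) = x ^ 0 / Nat.factorial 0 := by simp
  rw [this]
  exact Finset.single_le_sum (f := fun i => x ^ i / (Nat.factorial i : ℝ))
    (fun i _ => by positivity) (Finset.mem_range.2 (by omega))

lemma bose_nonneg {k : ℕ} (hk : 1 ≤ k) {w : ℝ} (hw : 0 < w) {u : ℝ} (hu : u ≠ 0) :
    0 ≤ bose k w u := by
  rw [bose_of_ne_zero hk w hu]
  have : 1 ≤ Real.exp (w * |u|) := Real.one_le_exp (by positivity)
  exact div_nonneg (by positivity) (by linarith)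

/-- Keeping the term of degree k + 2 in the exponential leaves |u|^{-2}: enough for the decay
hypothesis of Poisson summation and for summing over integer translates. -/
lemma bose_le {k : ℕ} (hk : 1 ≤ k) {w : ℝ} (hw : 0 < w) {u : ℝ} (hu : u ≠ 0) :
    bose k w u ≤ (k + 2).factorial / w ^ (k + 2) * |u| ^ (-2 : ℝ) := by
  have h := abs_pos.2 hu
  rw [bose_of_ne_zero hk w hu]
  have h1 := one_add_pow_div_factorial_le_exp (x := w * |u|) (by positivity) (n := k + 2) (by omega)
  calc _ ≤ |u| ^ k / ((w * |u|) ^ (k + 2) / (k + 2).factorial) := by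
        gcongr; linarith
    _ = _ := by
      rw [Real.rpow_neg h.le, Real.rpow_two, mul_pow, pow_add |u|]
      field_simp

lemma hasSum_bose {k : ℕ} (hk : 1 ≤ k) {w : ℝ} (hw : 0 < w) {u : ℝ} (hu : u ≠ 0) :
    HasSum (fun r : ℕ+ => absPowExp k (r * w) u) (bose k w u) := by
  have h := abs_pos.2 hu
  have hlt : Real.exp (-(w * |u|)) < 1 := Real.exp_lt_one_iff.2 (neg_lt_zero.2 (by positivity))
  rw [hasSum_pnat_iff_hasSum_succ (f := fun r : ℕ => absPowExp k (r * w) u)]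
  have h1 := (hasSum_geometric_of_lt_one (Real.exp_pos _).le hlt).mul_left
    (|u| ^ k * Real.exp (-(w * |u|)))
  have h2 : bose k w u = |u| ^ k * Real.exp (-(w * |u|)) * (1 - Real.exp (-(w * |u|)))⁻¹ := by
    rw [bose_of_ne_zero hk w hu, Real.exp_neg]
    have : Real.exp (w * |u|) - 1 ≠ 0 := by
      have : 1 < Real.exp (w * |u|) := Real.one_lt_exp_iff.2 (by positivity)
      linarith
    field_simp
  rw [h2]
  refine h1.congr_fun fun r => ?_
  rw [absPowExp, ← Real.exp_nat_mul, mul_assoc, ← Real.exp_add]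
  congr 2
  push_cast
  ring

lemma summable_pnat_inv_pow {k : ℕ} (hk : 1 ≤ k) :
    Summable fun r : ℕ+ => ((r : ℝ) ^ (k + 1))⁻¹ :=
  (summable_pnat_iff_summable_nat (f := fun n : ℕ => ((n : ℝ) ^ (k + 1))⁻¹)).2
    (Real.summable_nat_pow_inv.2 (by omega))

/-- The Fourier transform of `bose`, as a series over the terms of its geometric expansion. -/
lemma hasSum_fourier_bose {k : ℕ} (hk : 1 ≤ k) {w : ℝ} (hw : 0 < w) (b : ℝ) :
    HasSum (fun r : ℕ+ => k.factorial / ((r : ℂ) * w + 2 * π * b * Complex.I) ^ (k + 1)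
        + k.factorial / ((r : ℂ) * w - 2 * π * b * Complex.I) ^ (k + 1))
      (FourierTransform.fourier (fun u => (bose k w u : ℂ)) b) := by
  set F : ℕ+ → ℝ → ℂ := fun r u =>
    (absPowExp k (r * w) u : ℂ) * Complex.exp (-((2 * π * b : ℝ) * Complex.I) * u) with hF
  have hrw (r : ℕ+) : 0 < (r : ℝ) * w := by positivity
  have hint (r : ℕ+) : Integrable (F r) := (integrable_absPowExp_mul_cexp (hrw r) k _).1
  have hval (r : ℕ+) : ∫ u, F r u = k.factorial / ((r : ℂ) * w + 2 * π * b * Complex.I) ^ (k + 1)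
        + k.factorial / ((r : ℂ) * w - 2 * π * b * Complex.I) ^ (k + 1) := by
    rw [hF, (integrable_absPowExp_mul_cexp (hrw r) k _).2]
    push_cast
    rfl
  have hnorm (r : ℕ+) : ∫ u, ‖F r u‖ = 2 * k.factorial / w ^ (k + 1) * ((r : ℝ) ^ (k + 1))⁻¹ := by
    have : ∀ u, ‖F r u‖ = absPowExp k (r * w) u := fun u => by
      rw [hF]
      simp only [norm_mul, Complex.norm_exp, Complex.norm_real]
      rw [Real.norm_of_nonneg (by unfold absPowExp; positivity)]
      simp
    simp_rw [this]
    rw [(integral_absPowExp (hrw r) k).2, mul_pow]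
    field_simp
  have hsum : Summable fun r => ∫ u, ‖F r u‖ := by
    simp_rw [hnorm]
    exact (summable_pnat_inv_pow hk).mul_left _
  have key := hasSum_integral_of_summable_integral_norm hint hsum
  simp_rw [hval] at key
  rw [Real.fourier_real_eq_integral_exp_smul]
  suffices h : ∫ u : ℝ, Complex.exp (((-2 * π * u * b : ℝ) : ℂ) * Complex.I) • (bose k w u : ℂ)
      = ∫ u, ∑' r, F r u by rwa [h]
  refine integral_congr_ae ?_
  have h0 : ∀ᵐ u : ℝ, u ≠ 0 := by
    rw [ae_iff]; simp
  filter_upwards [h0] with u hu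
  have h1 := (Complex.hasSum_ofReal.2 (hasSum_bose hk hw hu)).mul_right
    (Complex.exp (-((2 * π * b : ℝ) * Complex.I) * u))
  rw [h1.tsum_eq, smul_eq_mul, mul_comm]
  congr 2
  push_cast
  ring

/-- The Lambert-type series `∑_{d ≥ 1} d^k e^{-dv}`. -/
noncomputable def lambertSum (k : ℕ) (v : ℝ) : ℂ :=
  ∑' d : ℕ+, (d : ℂ) ^ k * Complex.exp (-v) ^ (d : ℕ)

/-- Lipschitz's formula for `∑ d^k e^{-dv}`, with the terms of index `±r` paired. -/
lemma hasSum_lipschitz {k : ℕ} (hk : 1 ≤ k) {v : ℝ} (hv : 0 < v) :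
    HasSum (fun r : ℕ+ => 1 / ((v : ℂ) + 2 * π * r * Complex.I) ^ (k + 1)
        + 1 / ((v : ℂ) - 2 * π * r * Complex.I) ^ (k + 1))
      (lambertSum k v / k.factorial - 1 / (v : ℂ) ^ (k + 1)) := by
  have hpi : (π : ℂ) ≠ 0 := by exact_mod_cast Real.pi_ne_zero
  -- At z = iv/(2π) the nome e^{2πiz} is e^{-v}, so the q-expansion of ∑ (z + n)^{-k-1} is the
  -- Lambert-type series.
  set z : UpperHalfPlane := ⟨Complex.I * (v / (2 * π) : ℝ), by
    rw [Complex.I_mul_im, Complex.ofReal_re]; positivity⟩ with hz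
  have hzc : (z : ℂ) = Complex.I * v / (2 * π) := by
    change Complex.I * ((v / (2 * π) : ℝ) : ℂ) = _
    push_cast; ring
  set f : ℤ → ℂ := fun n => 1 / ((z : ℂ) + n) ^ (k + 1) with hf
  have hfs : Summable f := by
    have := EisensteinSeries.linear_right_summable z 1 (k := (k + 1 : ℕ)) (by omega)
    refine this.congr fun n => ?_
    rw [zpow_natCast]
    simp [hf]
  have h1 := EisensteinSeries.qExpansion_identity_pnat hk z
  have hq : (2 * π * Complex.I * z : ℂ) = -v := by
    rw [hzc]
    field_simp
    rw [Complex.I_sq]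
    ring
  rw [hq] at h1
  have h2 := tsum_int_eq_zero_add_tsum_pnat hfs
  have hs1 : Summable fun r : ℕ+ => f r := (summable_pnat_iff_summable_nat
    (f := fun n : ℕ => f n)).2 (summable_int_iff_summable_nat_and_neg.1 hfs).1
  have hs2 : Summable fun r : ℕ+ => f (-r) := (summable_pnat_iff_summable_nat
    (f := fun n : ℕ => f (-n))).2 (summable_int_iff_summable_nat_and_neg.1 hfs).2
  have hI : (-2 * π * Complex.I : ℂ) ≠ 0 := by simp [hpi]
  have hterm (n : ℤ) : 1 / ((v : ℂ) - 2 * π * n * Complex.I) ^ (k + 1)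
      = ((-2 * π * Complex.I : ℂ) ^ (k + 1))⁻¹ * f n := by
    have : (v : ℂ) - 2 * π * n * Complex.I = (-2 * π * Complex.I) * (z + n) := by
      rw [hzc]
      field_simp
      linear_combination (v : ℂ) * Complex.I_sq
    rw [this, mul_pow, hf]
    simp [mul_comm]
  have h3 := (hs1.hasSum.add hs2.hasSum).mul_left ((-2 * π * Complex.I : ℂ) ^ (k + 1))⁻¹
  have h0 := hterm 0
  have h4 : lambertSum k v / k.factorial - 1 / (v : ℂ) ^ (k + 1)
      = ((-2 * π * Complex.I : ℂ) ^ (k + 1))⁻¹ * (∑' r : ℕ+, f r + ∑' r : ℕ+, f (-r)) := by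
    have hsum : ∑' r : ℕ+, f r + ∑' r : ℕ+, f (-r) = ∑' n, f n - f 0 := by rw [h2]; ring
    have h5 : 1 / (v : ℂ) ^ (k + 1) = ((-2 * π * Complex.I : ℂ) ^ (k + 1))⁻¹ * f 0 := by
      simpa using h0
    rw [hsum, mul_sub, ← h5, h1, lambertSum]
    field_simp
  rw [h4]
  refine h3.congr_fun fun r => ?_
  have e1 := hterm r
  have e2 := hterm (-r)
  push_cast at e1 e2
  rw [mul_add, ← e1, ← e2]
  ring

lemma I_mul_pow_of_odd {k : ℕ} (hk : Odd k) (c : ℂ) :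
    (c * Complex.I) ^ (k + 1) = (-1) ^ ((k + 1) / 2) * c ^ (k + 1) := by
  obtain ⟨j, rfl⟩ := hk
  rw [mul_pow, show (2 * j + 1 + 1) / 2 = j + 1 by omega, show 2 * j + 1 + 1 = 2 * (j + 1) by ring,
    pow_mul Complex.I, Complex.I_sq, mul_comm]

lemma neg_pow_of_odd {k : ℕ} (hk : Odd k) (c : ℂ) : (-c) ^ (k + 1) = c ^ (k + 1) :=
  (hk.add_one).neg_pow c

lemma fourier_bose_neg {k : ℕ} (hk : 1 ≤ k) {w : ℝ} (hw : 0 < w) (b : ℝ) :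
    FourierTransform.fourier (fun u => (bose k w u : ℂ)) (-b)
      = FourierTransform.fourier (fun u => (bose k w u : ℂ)) b := by
  refine (hasSum_fourier_bose hk hw (-b)).unique
    ((hasSum_fourier_bose hk hw b).congr_fun fun r => ?_)
  push_cast
  ring

/-- With w = 4π²/y one has rw ± 2πim = ±(2πi/y)(my ∓ 2πir), so the sum over r is Lipschitz's formula
at v = my. Since k + 1 is even, the outer sign drops out and i^{k+1} is the real sign
(-1)^{(k+1)/2}. -/
lemma fourier_bose_pnat {k : ℕ} (hk : Odd k) {y : ℝ} (hy : 0 < y) (m : ℕ+) :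
    FourierTransform.fourier (fun u => (bose k (4 * π ^ 2 / y) u : ℂ)) m
      = (-1) ^ ((k + 1) / 2) * (y / (2 * π) : ℂ) ^ (k + 1)
        * (lambertSum k (m * y) - k.factorial / ((m : ℂ) * y) ^ (k + 1)) := by
  have hk1 : 1 ≤ k := hk.pos
  have hpi : (π : ℂ) ≠ 0 := by exact_mod_cast Real.pi_ne_zero
  have hy0 : (y : ℂ) ≠ 0 := by exact_mod_cast hy.ne'
  have hkf : (k.factorial : ℂ) ≠ 0 := Nat.cast_ne_zero.2 k.factorial_ne_zero
  have hm : (0 : ℝ) < m := by exact_mod_cast m.pos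
  have h1 := (hasSum_lipschitz hk1 (mul_pos hm hy)).mul_left
    ((-1) ^ ((k + 1) / 2) * (y / (2 * π) : ℂ) ^ (k + 1) * k.factorial)
  have h2 := hasSum_fourier_bose hk1 (w := 4 * π ^ 2 / y) (by positivity) m
  have h3 : (-1) ^ ((k + 1) / 2) * (y / (2 * π) : ℂ) ^ (k + 1)
        * (lambertSum k (m * y) - k.factorial / ((m : ℂ) * y) ^ (k + 1))
      = (-1) ^ ((k + 1) / 2) * (y / (2 * π) : ℂ) ^ (k + 1) * k.factorial *
        (lambertSum k (m * y) / k.factorial - 1 / ((m * y : ℝ) : ℂ) ^ (k + 1)) := by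
    push_cast
    field_simp
  rw [h3]
  refine h2.unique (h1.congr_fun fun r => ?_)
  have hu : (-1 : ℂ) ^ ((k + 1) / 2) * (-1) ^ ((k + 1) / 2) = 1 := by
    rw [← mul_pow]; norm_num
  have e1 : (r : ℂ) * ((4 * π ^ 2 / y : ℝ) : ℂ) + 2 * π * (m : ℝ) * Complex.I
      = (2 * π / y * Complex.I) * (((m * y : ℝ) : ℂ) - 2 * π * r * Complex.I) := by
    push_cast
    field_simp
    ring_nf
    rw [Complex.I_sq]
    ring
  have e2 : (r : ℂ) * ((4 * π ^ 2 / y : ℝ) : ℂ) - 2 * π * (m : ℝ) * Complex.I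
      = -(2 * π / y * Complex.I) * (((m * y : ℝ) : ℂ) + 2 * π * r * Complex.I) := by
    push_cast
    field_simp
    ring_nf
    rw [Complex.I_sq]
    ring
  have hinv : ((-1 : ℂ) ^ ((k + 1) / 2) * (2 * π / y : ℂ) ^ (k + 1))⁻¹
      = (-1) ^ ((k + 1) / 2) * (y / (2 * π) : ℂ) ^ (k + 1) := by
    rw [mul_inv, inv_eq_of_mul_eq_one_left hu, ← inv_pow, inv_div]
  rw [e1, e2, mul_pow _ ((_ : ℂ) - _), mul_pow _ ((_ : ℂ) + _), neg_pow_of_odd hk, I_mul_pow_of_odd hk, ← hinv]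
  generalize ((m * y : ℝ) : ℂ) - 2 * π * r * Complex.I = A
  generalize ((m * y : ℝ) : ℂ) + 2 * π * r * Complex.I = B
  generalize (2 * π / y : ℂ) = C
  generalize (-1 : ℂ) ^ ((k + 1) / 2) = e
  ring

lemma tsum_fourier_bose_zero {k : ℕ} (hk : 1 ≤ k) {w : ℝ} (hw : 0 < w) :
    FourierTransform.fourier (fun u => (bose k w u : ℂ)) 0
      = 2 * k.factorial / (w : ℂ) ^ (k + 1) * riemannZeta (k + 1) := by
  have h := hasSum_fourier_bose hk hw 0
  have hz : HasSum (fun r : ℕ+ => 1 / (r : ℂ) ^ (k + 1)) (riemannZeta (k + 1)) := by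
    have h1 := zeta_nat_eq_tsum_of_gt_one (k := k + 1) (by omega)
    have hs : Summable fun n : ℕ => 1 / (n : ℂ) ^ (k + 1) := by
      have := (Real.summable_one_div_nat_pow (p := k + 1)).2 (by omega)
      have := Complex.ofRealCLM.summable this
      refine this.congr fun n => ?_
      simp
    push_cast at h1
    rw [h1, ← tsum_pnat_eq_tsum_of_eq_zero (f := fun n : ℕ => 1 / (n : ℂ) ^ (k + 1))]
    · exact (summable_pnat_iff_summable_nat (f := fun n : ℕ => 1 / (n : ℂ) ^ (k + 1))).2 hs |>.hasSum
    · simp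
  refine h.unique ((hz.mul_left (2 * k.factorial / (w : ℂ) ^ (k + 1))).congr_fun fun r => ?_)
  have : (w : ℂ) ≠ 0 := by exact_mod_cast hw.ne'
  simp only [Complex.ofReal_zero, mul_zero, zero_mul, add_zero, sub_zero, mul_pow]
  field_simp
  ring

lemma summable_prod_pow_mul_cexp (k : ℕ) {y : ℝ} (hy : 0 < y) :
    Summable fun p : ℕ+ × ℕ+ => (p.1 : ℂ) ^ k * Complex.exp (-y) ^ (p.1 * p.2 : ℕ) := by
  have h : ‖Complex.exp (-y)‖ < 1 := by
    rw [Complex.norm_exp]; simpa using hy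
  refine ((Equiv.prodComm ℕ+ ℕ+).summable_iff.2 (summable_prod_mul_pow k h)).congr fun p => ?_
  simp [mul_comm]

lemma hasSum_lambertSum_mul (k : ℕ) {y : ℝ} (hy : 0 < y) (m : ℕ+) :
    HasSum (fun d : ℕ+ => (d : ℂ) ^ k * Complex.exp (-y) ^ (d * m : ℕ)) (lambertSum k (m * y)) := by
  have h := ((Equiv.prodComm ℕ+ ℕ+).summable_iff.2
    (summable_prod_pow_mul_cexp k hy)).prod_factor m
  have h2 : lambertSum k (m * y)
      = ∑' d : ℕ+, (d : ℂ) ^ k * Complex.exp (-y) ^ (d * m : ℕ) := by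
    refine tsum_congr fun d => ?_
    rw [← Complex.exp_nat_mul, ← Complex.exp_nat_mul]
    congr 2
    push_cast
    ring
  rw [h2]
  exact h.hasSum

/-- Twisted Lambert series: a bounded twist in `m`. -/
lemma hasSum_mul_lambertSum (k : ℕ) {y : ℝ} (hy : 0 < y) {g : ℕ+ → ℂ} {C : ℝ}
    (hg : ∀ m, ‖g m‖ ≤ C) :
    Summable (fun p : ℕ+ × ℕ+ => (p.1 : ℂ) ^ k * g p.2 * Complex.exp (-y) ^ (p.1 * p.2 : ℕ)) ∧
    HasSum (fun m : ℕ+ => g m * lambertSum k (m * y))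
      (∑' p : ℕ+ × ℕ+, (p.1 : ℂ) ^ k * g p.2 * Complex.exp (-y) ^ (p.1 * p.2 : ℕ)) := by
  have h1 : Summable fun p : ℕ+ × ℕ+ =>
      (p.1 : ℂ) ^ k * g p.2 * Complex.exp (-y) ^ (p.1 * p.2 : ℕ) := by
    refine Summable.of_norm_bounded ((summable_prod_pow_mul_cexp k hy).norm.mul_left C) fun p => ?_
    calc _ = ‖g p.2‖ * ‖(p.1 : ℂ) ^ k * Complex.exp (-y) ^ (p.1 * p.2 : ℕ)‖ := by
          simp only [norm_mul]; ring
      _ ≤ _ := by gcongr; exact hg _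
  refine ⟨h1, ?_⟩
  have h2 := (Equiv.prodComm ℕ+ ℕ+).summable_iff.2 h1
  rw [← (Equiv.prodComm ℕ+ ℕ+).tsum_eq]
  refine h2.hasSum.prod_fiberwise fun m => ?_
  refine ((hasSum_lambertSum_mul k hy m).mul_left (g m)).congr_fun fun d => ?_
  simp
  ring

lemma summable_pnat_inv_pow_complex {k : ℕ} (hk : 1 ≤ k) :
    Summable fun r : ℕ+ => ((r : ℂ) ^ (k + 1))⁻¹ := by
  refine (Complex.ofRealCLM.summable (summable_pnat_inv_pow hk)).congr fun n => ?_
  simp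

lemma isBigO_bose {k : ℕ} (hk : 1 ≤ k) {w : ℝ} (hw : 0 < w) :
    Asymptotics.IsBigO (cocompact ℝ) (fun u => (bose k w u : ℂ)) (fun u : ℝ => |u| ^ (-2 : ℝ)) := by
  refine Asymptotics.IsBigO.of_bound ((k + 2).factorial / w ^ (k + 2)) ?_
  filter_upwards [(isCompact_singleton (x := (0 : ℝ))).compl_mem_cocompact] with u hu
  have hu : u ≠ 0 := hu
  rw [Complex.norm_real, Real.norm_of_nonneg (bose_nonneg hk hw hu),
    Real.norm_of_nonneg (by positivity)]
  exact bose_le hk hw hu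

/-- The periodization of `bose`, as a cosine series. -/
lemma tsum_int_bose {k : ℕ} (hk : Odd k) {y : ℝ} (hy : 0 < y) (θ : ℝ) :
    ∑' n : ℤ, (bose k (4 * π ^ 2 / y) (θ + n) : ℂ)
      = 2 * k.factorial / ((4 * π ^ 2 / y : ℝ) : ℂ) ^ (k + 1) * riemannZeta (k + 1)
        + 2 * (-1) ^ ((k + 1) / 2) * (y / (2 * π) : ℂ) ^ (k + 1)
          * ((∑' p : ℕ+ × ℕ+, (p.1 : ℂ) ^ k * (Real.cos (2 * π * p.2 * θ) : ℂ)
              * Complex.exp (-y) ^ (p.1 * p.2 : ℕ))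
            - k.factorial / (y : ℂ) ^ (k + 1)
              * ∑' m : ℕ+, (Real.cos (2 * π * m * θ) : ℂ) / (m : ℂ) ^ (k + 1)) := by
  have hk1 : 1 ≤ k := hk.pos
  have hw : 0 < 4 * π ^ 2 / y := by positivity
  have hy0 : (y : ℂ) ≠ 0 := by exact_mod_cast hy.ne'
  set f : ℝ → ℂ := fun u => (bose k (4 * π ^ 2 / y) u : ℂ) with hf
  have hcoef (m : ℕ+) := fourier_bose_pnat hk hy m
  have hneg (b : ℝ) := fourier_bose_neg hk1 hw b
  have hcos (m : ℕ+) : ‖(Real.cos (2 * π * m * θ) : ℂ)‖ ≤ 1 := by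
    rw [Complex.norm_real]; exact Real.abs_cos_le_one _
  have hsA : Summable fun m : ℕ+ => lambertSum k (m * y) := by
    have := (hasSum_mul_lambertSum k hy (g := fun _ => 1) (C := 1) (by simp)).2.summable
    simpa using this
  have hsB := (summable_pnat_inv_pow_complex hk1).mul_left (k.factorial / (y : ℂ) ^ (k + 1))
  have hsP : Summable fun m : ℕ+ => FourierTransform.fourier f (m : ℝ) := by
    refine ((hsA.sub hsB).mul_left
      ((-1) ^ ((k + 1) / 2) * (y / (2 * π) : ℂ) ^ (k + 1))).congr fun m => ?_
    rw [hcoef, mul_pow]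
    field_simp
  have hsZ : Summable fun n : ℤ => FourierTransform.fourier f (n : ℝ) := by
    have h1 : Summable fun n : ℕ => FourierTransform.fourier f (((n : ℤ) : ℝ)) :=
      (summable_pnat_iff_summable_nat
        (f := fun n : ℕ => FourierTransform.fourier f (((n : ℤ) : ℝ)))).1 (by simpa using hsP)
    refine summable_int_iff_summable_nat_and_neg.2 ⟨h1, h1.congr fun n => ?_⟩
    push_cast
    rw [hneg]
  -- Poisson summation at the point θ. The transform is even, so frequencies ±m combine into cosines
  -- and frequency 0 contributes ζ(k + 1).
  have hP := Real.tsum_eq_tsum_fourier_of_rpow_decay_of_summable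
    (Complex.continuous_ofReal.comp (continuous_bose hw)) one_lt_two (isBigO_bose hk1 hw) hsZ θ
  change ∑' n : ℤ, f (θ + n) = _
  have hbnd (n : ℤ) : ‖fourier n (θ : UnitAddCircle)‖ ≤ 1 := by
    rw [fourier_coe_apply, Complex.norm_exp]
    simp
  have hsF : Summable fun n : ℤ =>
      FourierTransform.fourier f (n : ℝ) * fourier n (θ : UnitAddCircle) := by
    refine Summable.of_norm_bounded hsZ.norm fun n => ?_
    rw [norm_mul]
    exact mul_le_of_le_one_right (norm_nonneg _) (hbnd n)
  have hsF1 : Summable fun n : ℕ+ =>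
      FourierTransform.fourier f ((n : ℤ) : ℝ) * fourier (n : ℤ) (θ : UnitAddCircle) :=
    (summable_pnat_iff_summable_nat (f := fun n : ℕ => FourierTransform.fourier f ((n : ℤ) : ℝ)
      * fourier (n : ℤ) (θ : UnitAddCircle))).2 (summable_int_iff_summable_nat_and_neg.1 hsF).1
  have hsF2 : Summable fun n : ℕ+ =>
      FourierTransform.fourier f ((-(n : ℤ) : ℤ) : ℝ) * fourier (-(n : ℤ)) (θ : UnitAddCircle) :=
    (summable_pnat_iff_summable_nat (f := fun n : ℕ =>
      FourierTransform.fourier f ((-(n : ℤ) : ℤ) : ℝ)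
      * fourier (-(n : ℤ)) (θ : UnitAddCircle))).2 (summable_int_iff_summable_nat_and_neg.1 hsF).2
  refine hP.trans ?_
  change ∑' n : ℤ, FourierTransform.fourier f (n : ℝ) * fourier n (θ : UnitAddCircle) = _
  rw [tsum_int_eq_zero_add_tsum_pnat hsF, add_assoc, ← hsF1.tsum_add hsF2]
  have h0 : FourierTransform.fourier f ((0 : ℤ) : ℝ) * fourier (0 : ℤ) (θ : UnitAddCircle)
      = 2 * k.factorial / ((4 * π ^ 2 / y : ℝ) : ℂ) ^ (k + 1) * riemannZeta (k + 1) := by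
    rw [Int.cast_zero, tsum_fourier_bose_zero hk1 hw]
    simp
  rw [h0]
  congr 1
  have hA := (hasSum_mul_lambertSum k hy hcos).2
  have hBs : Summable fun m : ℕ+ => (Real.cos (2 * π * m * θ) : ℂ) / (m : ℂ) ^ (k + 1) := by
    refine Summable.of_norm_bounded (summable_pnat_inv_pow_complex hk1).norm fun m => ?_
    rw [div_eq_mul_inv, norm_mul]
    exact mul_le_of_le_one_left (norm_nonneg _) (hcos m)
  have hB := hBs.hasSum.mul_left (k.factorial / (y : ℂ) ^ (k + 1))
  have hAB := (hA.sub hB).mul_left (2 * (-1) ^ ((k + 1) / 2) * (y / (2 * π) : ℂ) ^ (k + 1))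
  rw [← hAB.tsum_eq]
  refine tsum_congr fun m => ?_
  have hc2 : fourier (m : ℤ) (θ : UnitAddCircle) + fourier (-(m : ℤ)) (θ : UnitAddCircle)
      = 2 * (Real.cos (2 * π * m * θ) : ℂ) := by
    rw [fourier_coe_apply, fourier_coe_apply, Complex.ofReal_cos, Complex.two_cos]
    push_cast
    congr 2 <;> ring
  have hm1 : FourierTransform.fourier f ((m : ℤ) : ℝ) = FourierTransform.fourier f (m : ℝ) := by
    push_cast; rfl
  have hm2 : FourierTransform.fourier f ((-(m : ℤ) : ℤ) : ℝ)
      = FourierTransform.fourier f (m : ℝ) := by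
    push_cast; exact hneg _
  rw [hm1, hm2, ← mul_add, hc2, hcoef, mul_pow]
  field_simp

lemma summable_int_bose {k : ℕ} (hk : 1 ≤ k) {w : ℝ} (hw : 0 < w) {θ : ℝ} (h0 : 0 < θ)
    (h1 : θ < 1) : Summable fun n : ℤ => bose k w (θ + n) := by
  have hne (n : ℤ) : θ + n ≠ 0 := by
    intro h
    have h2 : ((-n : ℤ) : ℝ) = θ := by push_cast; linarith
    rw [← h2] at h0 h1
    have h3 : 0 < -n := by exact_mod_cast h0
    have h4 : -n < 1 := by exact_mod_cast h1
    omega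
  have hs := ((Real.summable_one_div_int_add_rpow θ 2).2 one_lt_two).mul_left
    ((k + 2).factorial / w ^ (k + 2))
  refine Summable.of_nonneg_of_le (fun n => bose_nonneg hk hw (hne n)) (fun n => ?_) hs
  refine (bose_le hk hw (hne n)).trans (le_of_eq ?_)
  rw [Real.rpow_neg (abs_nonneg _), add_comm θ, one_div]

lemma absPowExp_of_pos (k : ℕ) (a : ℝ) {u : ℝ} (hu : 0 < u) :
    absPowExp k a u = u ^ k * Real.exp (-a * u) := by
  rw [absPowExp, abs_of_pos hu]

/-- The periodization of `bose` as a double series. -/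
lemma hasSum_double_absPowExp {k : ℕ} (hk : 1 ≤ k) {w : ℝ} (hw : 0 < w) {θ : ℝ} (h0 : 0 < θ)
    (h1 : θ < 1) : HasSum (fun p : ℕ+ × ℕ => absPowExp k (p.1 * w) (p.2 + θ)
      + absPowExp k (p.1 * w) (p.2 + 1 - θ)) (∑' n : ℤ, bose k w (θ + n)) := by
  have hm (m : ℕ) : (0 : ℝ) < m + θ := by positivity
  have hm' (m : ℕ) : (0 : ℝ) < m + 1 - θ := by linarith [m.cast_nonneg (α := ℝ)]
  -- Pairing n = m with n = -(m + 1) gives the points m + θ and -(m + 1 - θ); evenness removes the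
  -- second sign. Neither is 0 because 0 < θ < 1, so the geometric expansion applies.
  have hs := (summable_int_bose hk hw h0 h1).hasSum.nat_add_neg_add_one
  have hin (m : ℕ) : HasSum (fun r : ℕ+ => absPowExp k (r * w) (m + θ)
      + absPowExp k (r * w) (m + 1 - θ))
      (bose k w (θ + ((m : ℤ) : ℝ)) + bose k w (θ + ((-((m : ℤ) + 1) : ℤ) : ℝ))) := by
    have e1 : θ + ((m : ℤ) : ℝ) = m + θ := by push_cast; ring
    have e2 : bose k w (θ + ((-((m : ℤ) + 1) : ℤ) : ℝ)) = bose k w (m + 1 - θ) := by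
      have : θ + ((-((m : ℤ) + 1) : ℤ) : ℝ) = -(m + 1 - θ) := by push_cast; ring
      rw [this, bose, bose, abs_neg]
    rw [e1, e2]
    exact (hasSum_bose hk hw (hm m).ne').add (hasSum_bose hk hw (hm' m).ne')
  set f : ℕ × ℕ+ → ℝ := fun q => absPowExp k (q.2 * w) (q.1 + θ)
      + absPowExp k (q.2 * w) (q.1 + 1 - θ) with hf
  have hnn : 0 ≤ f := fun q => by
    simp only [hf, absPowExp, Pi.zero_apply]
    positivity
  have hfs : Summable f := by
    rw [summable_prod_of_nonneg hnn]
    refine ⟨fun m => (hin m).summable, hs.summable.congr fun m => ?_⟩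
    exact (hin m).tsum_eq.symm
  have := (hfs.hasSum.prod_fiberwise hin).unique hs
  rw [← this]
  exact (Equiv.prodComm ℕ+ ℕ).hasSum_iff.2 hfs.hasSum

/-- Transformation formula of the Lambert series `∑ d^k cos(2πmθ) e^{-dmy}`. -/
theorem lambert_cos_transformation {k : ℕ} (hk : Odd k) {y : ℝ} (hy : 0 < y) {θ : ℝ} (h0 : 0 < θ)
    (h1 : θ < 1) :
    ∑' p : ℕ+ × ℕ+, (p.1 : ℂ) ^ k * (Real.cos (2 * π * p.2 * θ) : ℂ)
        * Complex.exp (-y) ^ (p.1 * p.2 : ℕ)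
      = (-1) ^ ((k + 1) / 2) * (2 * π / y : ℂ) ^ (k + 1) / 2
          * ∑' p : ℕ+ × ℕ, ((absPowExp k (p.1 * (4 * π ^ 2 / y)) (p.2 + θ)
            + absPowExp k (p.1 * (4 * π ^ 2 / y)) (p.2 + 1 - θ) : ℝ) : ℂ)
        - (-1) ^ ((k + 1) / 2) * k.factorial * riemannZeta (k + 1) / (2 * π : ℂ) ^ (k + 1)
        + k.factorial / (y : ℂ) ^ (k + 1)
              * ∑' m : ℕ+, (Real.cos (2 * π * m * θ) : ℂ) / (m : ℂ) ^ (k + 1) := by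
  have hw : 0 < 4 * π ^ 2 / y := by positivity
  have hpi : (π : ℂ) ≠ 0 := by exact_mod_cast Real.pi_ne_zero
  have hy0 : (y : ℂ) ≠ 0 := by exact_mod_cast hy.ne'
  have hD := Complex.hasSum_ofReal.2 (hasSum_double_absPowExp hk.pos hw h0 h1)
  have hP := tsum_int_bose hk hy θ
  rw [hD.tsum_eq, Complex.ofReal_tsum, hP]
  have hu : (-1 : ℂ) ^ ((k + 1) / 2) * (-1) ^ ((k + 1) / 2) = 1 := by
    rw [← mul_pow]; norm_num
  have h2 : (2 * π / y : ℂ) ^ (k + 1) * (y / (2 * π) : ℂ) ^ (k + 1) = 1 := by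
    rw [← mul_pow, div_mul_div_cancel₀ hy0, div_self (by simp [hpi]), one_pow]
  have h3 : (2 * π / y : ℂ) ^ (k + 1) / ((4 * π ^ 2 / y : ℝ) : ℂ) ^ (k + 1)
      = 1 / (2 * π : ℂ) ^ (k + 1) := by
    rw [← div_pow, ← one_div_pow]
    congr 1
    push_cast
    field_simp
    norm_num
  set F := ∑' p : ℕ+ × ℕ+, (p.1 : ℂ) ^ k * (Real.cos (2 * π * p.2 * θ) : ℂ)
        * Complex.exp (-y) ^ (p.1 * p.2 : ℕ)
  set S := ∑' m : ℕ+, (Real.cos (2 * π * m * θ) : ℂ) / (m : ℂ) ^ (k + 1)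
  generalize (-1 : ℂ) ^ ((k + 1) / 2) = e at *
  linear_combination (-e * k.factorial * riemannZeta (k + 1)) * h3
    - (F - k.factorial / (y : ℂ) ^ (k + 1) * S) *
      (e * e * h2 + hu)

end PeriodizedPoissonSum

/-! ### Exchanging sum and integral against Euler's kernel. -/

section TermwiseIntegration

open MeasureTheory Set Filter

lemma integrable_tsum_of_summable_integral_norm {α ι : Type*} [MeasurableSpace α] {μ : Measure α}
    [Countable ι] {F : ι → α → ℂ} (hF : ∀ i, Integrable (F i) μ)
    (hs : Summable fun i => ∫ a, ‖F i a‖ ∂μ) (hp : ∀ᵐ a ∂μ, Summable fun i => F i a) :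
    Integrable (fun a => ∑' i, F i a) μ := by
  refine ⟨?_, ?_⟩
  · refine aestronglyMeasurable_of_tendsto_ae (atTop : Filter (Finset ι))
      (f := fun s a => ∑ i ∈ s, F i a) (fun s => ?_) ?_
    · exact Finset.aestronglyMeasurable_fun_sum s fun i _ => (hF i).1
    · filter_upwards [hp] with a ha using ha.hasSum
  · calc ∫⁻ a, ‖∑' i, F i a‖ₑ ∂μ ≤ ∫⁻ a, ∑' i, ‖F i a‖ₑ ∂μ :=
        lintegral_mono fun a => enorm_tsum_le_tsum_enorm
      _ = ∑' i, ∫⁻ a, ‖F i a‖ₑ ∂μ := lintegral_tsum fun i => (hF i).1.enorm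
      _ = ∑' i, ENNReal.ofReal (∫ a, ‖F i a‖ ∂μ) := by
        refine tsum_congr fun i => ?_
        rw [ofReal_integral_norm_eq_lintegral_enorm (hF i)]
      _ = ENNReal.ofReal (∑' i, ∫ a, ‖F i a‖ ∂μ) :=
        (ENNReal.ofReal_tsum_of_nonneg (fun i => integral_nonneg fun a => norm_nonneg _) hs).symm
      _ < ⊤ := ENNReal.ofReal_lt_top

lemma integrableOn_eulerKernel_mul_exp {s : ℂ} (hs : 0 < s.re) {A : ℝ} (hA : 0 ≤ A) :
    IntegrableOn (fun t : ℝ => eulerKernel s t * (Real.exp (-A * t) : ℂ)) (Ioi 0) := by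
  have hm := measurable_eulerKernel s
  refine Integrable.mono' (integrableOn_eulerKernel hs).norm
    (by fun_prop : Measurable _).aestronglyMeasurable ?_
  refine (ae_restrict_iff' measurableSet_Ioi).2 (Eventually.of_forall fun t ht => ?_)
  have ht : 0 < t := ht
  rw [norm_mul, Complex.norm_real, Real.norm_of_nonneg (Real.exp_pos _).le]
  refine mul_le_of_le_one_right (norm_nonneg _) (Real.exp_le_one_iff.2 ?_)
  nlinarith

lemma integral_eulerKernel_mul_exp {s : ℂ} (hs : 0 < s.re) {A : ℝ} (hA : 0 ≤ A) :
    ∫ t in Ioi (0 : ℝ), eulerKernel s t * (Real.exp (-A * t) : ℂ)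
      = Complex.Gamma s / ((A + 1 : ℝ) : ℂ) ^ s := by
  have hA1 : 0 < A + 1 := by linarith
  have h := Complex.integral_cpow_mul_exp_neg_mul_Ioi hs hA1
  rw [one_div, Complex.inv_cpow _ _ (by
    rw [Complex.arg_ofReal_of_nonneg hA1.le]; exact Real.pi_pos.ne), inv_mul_eq_div] at h
  rw [← h]
  refine setIntegral_congr_fun measurableSet_Ioi fun t _ => ?_
  simp only [eulerKernel]
  rw [mul_right_comm, ← Complex.ofReal_mul, ← Real.exp_add, mul_comm]
  push_cast
  ring_nf

lemma integral_norm_eulerKernel_mul_exp {s : ℂ} (hs : 0 < s.re) {A : ℝ} (hA : 0 ≤ A) :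
    ∫ t in Ioi (0 : ℝ), ‖eulerKernel s t * (Real.exp (-A * t) : ℂ)‖
      = Real.Gamma s.re / (A + 1) ^ s.re := by
  have hA1 : 0 < A + 1 := by linarith
  have h := Real.integral_rpow_mul_exp_neg_mul_Ioi hs hA1
  rw [one_div, Real.inv_rpow hA1.le, inv_mul_eq_div] at h
  rw [← h]
  refine setIntegral_congr_fun measurableSet_Ioi fun t ht => ?_
  simp only [norm_mul, norm_eulerKernel s ht, Complex.norm_real,
    Real.norm_of_nonneg (Real.exp_pos _).le]
  rw [mul_right_comm, ← Real.exp_add, mul_comm]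
  ring_nf

/-- Termwise integration of a series of exponentials against Euler's kernel. -/
lemma integral_eulerKernel_mul_tsum {ι : Type*} [Countable ι] {s : ℂ} (hs : 0 < s.re) {b : ι → ℂ}
    {A : ι → ℝ} (hA : ∀ i, 0 ≤ A i) (hsum : Summable fun i => ‖b i‖ / (A i + 1) ^ s.re)
    (hp : ∀ t : ℝ, 0 < t → Summable fun i => b i * (Real.exp (-A i * t) : ℂ)) :
    IntegrableOn (fun t : ℝ => eulerKernel s t * ∑' i, b i * (Real.exp (-A i * t) : ℂ)) (Ioi 0) ∧
    ∫ t in Ioi (0 : ℝ), eulerKernel s t * ∑' i, b i * (Real.exp (-A i * t) : ℂ)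
      = Complex.Gamma s * ∑' i, b i / ((A i + 1 : ℝ) : ℂ) ^ s := by
  set F : ι → ℝ → ℂ := fun i t => b i * (eulerKernel s t * (Real.exp (-A i * t) : ℂ)) with hF
  have hint (i : ι) : IntegrableOn (F i) (Ioi 0) :=
    (integrableOn_eulerKernel_mul_exp hs (hA i)).const_mul _
  have hnorm (i : ι) : ∫ t in Ioi (0 : ℝ), ‖F i t‖
      = Real.Gamma s.re * (‖b i‖ / (A i + 1) ^ s.re) := by
    rw [hF]
    simp_rw [norm_mul (b i)]
    rw [integral_const_mul, integral_norm_eulerKernel_mul_exp hs (hA i)]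
    ring
  have hsn : Summable fun i => ∫ t in Ioi (0 : ℝ), ‖F i t‖ := by
    simp_rw [hnorm]
    exact hsum.mul_left _
  have heq (t : ℝ) : eulerKernel s t * ∑' i, b i * (Real.exp (-A i * t) : ℂ) = ∑' i, F i t := by
    rw [← tsum_mul_left]
    exact tsum_congr fun i => by rw [hF]; ring
  simp_rw [heq]
  refine ⟨integrable_tsum_of_summable_integral_norm hint hsn ?_, ?_⟩
  · refine (ae_restrict_iff' measurableSet_Ioi).2 (Eventually.of_forall fun t ht => ?_)
    exact ((hp t ht).mul_left (eulerKernel s t)).congr fun i => by rw [hF]; ring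
  · rw [← integral_tsum_of_summable_integral_norm hint hsn, ← tsum_mul_left]
    refine tsum_congr fun i => ?_
    rw [hF, integral_const_mul, integral_eulerKernel_mul_exp hs (hA i)]
    ring

/-- For z = a√(nx) one has (z/2)² = nX with X = a²x/4, so the prefactor (z/2)^{-ν} contains
n^{-ν/2}, which the weight n^{ν/2} cancels. -/
lemma cpow_mul_besselK {a x : ℝ} (ha : 0 < a) (hx : 0 < x) (ν : ℂ) (n : ℕ+) :
    ((n : ℕ) : ℂ) ^ (ν / 2) * besselK ν ((a * √((n : ℝ) * x) : ℝ) : ℂ)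
      = ((a ^ 2 * x / 4 : ℝ) : ℂ) ^ (-(ν / 2)) / 2 * besselInt (n * (a ^ 2 * x / 4)) ν := by
  have hn : (0 : ℝ) < n := by exact_mod_cast n.pos
  have hX : 0 < a ^ 2 * x / 4 := by positivity
  have hnx : 0 < (n : ℝ) * x := by positivity
  have hsq : (a * √((n : ℝ) * x) / 2) ^ 2 = n * (a ^ 2 * x / 4) := by
    rw [div_pow, mul_pow, Real.sq_sqrt hnx.le]; ring
  have hz : a * √((n : ℝ) * x) / 2 = (n * (a ^ 2 * x / 4)) ^ (1 / 2 : ℝ) := by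
    rw [← hsq, ← Real.sqrt_eq_rpow, Real.sqrt_sq (by positivity)]
  rw [besselK_eq_besselInt (by positivity), hsq, hz, ← Complex.ofReal_natCast]
  have h1 : (((n * (a ^ 2 * x / 4)) ^ (1 / 2 : ℝ) : ℝ) : ℂ) ^ (-ν)
      = (((n : ℕ) : ℝ) : ℂ) ^ (-(ν / 2)) * ((a ^ 2 * x / 4 : ℝ) : ℂ) ^ (-(ν / 2)) := by
    have h2 : (((n * (a ^ 2 * x / 4)) ^ (1 / 2 : ℝ) : ℝ) : ℂ) ^ (-ν)
        = ((n * (a ^ 2 * x / 4) : ℝ) : ℂ) ^ (-(ν / 2)) := by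
      rw [← Complex.cpow_mul_ofReal_nonneg (by positivity)]
      congr 1
      push_cast
      ring
    rw [h2, Complex.ofReal_mul, Complex.mul_cpow_ofReal_nonneg hn.le hX.le]
  have h3 : (((n : ℕ) : ℝ) : ℂ) ^ (ν / 2) * (((n : ℕ) : ℝ) : ℂ) ^ (-(ν / 2)) = 1 := by
    rw [← Complex.cpow_add _ _ (by exact_mod_cast hn.ne'), add_neg_cancel, Complex.cpow_zero]
  rw [h1]
  linear_combination (((a ^ 2 * x / 4 : ℝ) : ℂ) ^ (-(ν / 2)) / 2
    * besselInt (n * (a ^ 2 * x / 4)) ν) * h3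

/-- Termwise integration of `∑ c_n n^{ν/2} K_ν(a√(nx))`. -/
lemma tsum_besselK {k : ℕ} {ν : ℂ} (hν : 0 < ν.re) {a x : ℝ} (ha : 0 < a) (hx : 0 < x)
    {c : ℕ+ → ℂ} (hc : ∀ n : ℕ+, ‖c n‖ ≤ (n : ℝ) ^ (k + 1)) :
    Summable (fun n : ℕ+ => c n * (((n : ℕ) : ℂ) ^ (ν / 2)
      * besselK ν ((a * √((n : ℝ) * x) : ℝ) : ℂ))) ∧
    ((a ^ 2 * x / 4 : ℝ) : ℂ) ^ (ν / 2 + k + 1) * ∑' n : ℕ+, c n * (((n : ℕ) : ℂ) ^ (ν / 2)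
      * besselK ν ((a * √((n : ℝ) * x) : ℝ) : ℂ))
      = ((a ^ 2 * x / 4 : ℝ) : ℂ) ^ (k + 1) / 2 * ∫ t in Ioi (0 : ℝ), eulerKernel ν t *
          ∑' n : ℕ+, c n * Complex.exp (-((a ^ 2 * x / 4 / t : ℝ) : ℂ)) ^ (n : ℕ) := by
  set X := a ^ 2 * x / 4 with hXdef
  have hX : 0 < X := by positivity
  have hX0 : (X : ℂ) ≠ 0 := by exact_mod_cast hX.ne'
  have hn (n : ℕ+) : (0 : ℝ) < n := by exact_mod_cast n.pos
  set F : ℕ+ → ℝ → ℂ := fun n t => c n * ((Real.exp (-(n * X / t)) : ℂ) * eulerKernel ν t) with hF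
  have hint (n : ℕ+) : IntegrableOn (F n) (Ioi 0) :=
    (integrableOn_exp_mul_eulerKernel (mul_pos (hn n) hX) ν).const_mul _
  -- Coefficients of size n^{k+1} against decay n^{-p}: p = k + 3 leaves the summable n^{-2}.
  set p := k + 3 with hp
  set M := p.factorial * (X ^ p)⁻¹ * ∫ t in Ioi (0 : ℝ), Real.exp (-t) * t ^ (ν.re + p - 1) with hM
  have hgi : IntegrableOn (fun t : ℝ => Real.exp (-t) * t ^ (ν.re + p - 1)) (Ioi 0) :=
    Real.GammaIntegral_convergent (by positivity)
  have hnorm (n : ℕ+) : ∫ t in Ioi (0 : ℝ), ‖F n t‖ ≤ M * ((n : ℝ) ^ (1 + 1))⁻¹ := by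
    calc _ ≤ ∫ t in Ioi (0 : ℝ), (n : ℝ) ^ (k + 1) * (p.factorial * ((n * X) ^ p)⁻¹) *
          (Real.exp (-t) * t ^ (ν.re + p - 1)) := by
          refine setIntegral_mono_on (hint n).norm (hgi.const_mul _) measurableSet_Ioi
            fun t ht => ?_
          have ht : 0 < t := ht
          rw [hF]
          simp only [norm_mul (c n)]
          rw [mul_assoc]
          gcongr
          · exact hc n
          · exact norm_exp_mul_eulerKernel_le (mul_pos (hn n) hX) ν p ht
      _ = _ := by
          rw [integral_const_mul, hM, mul_pow, hp]
          have := (hn n).ne'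
          field_simp
          ring
  have hsn : Summable fun n => ∫ t in Ioi (0 : ℝ), ‖F n t‖ :=
    Summable.of_nonneg_of_le (fun n => integral_nonneg fun t => norm_nonneg _) hnorm
      ((summable_pnat_inv_pow le_rfl).mul_left M)
  have key := hasSum_integral_of_summable_integral_norm hint hsn
  have hval (n : ℕ+) : ∫ t in Ioi (0 : ℝ), F n t = c n * besselInt (n * X) ν := by
    rw [hF, integral_const_mul, besselInt]
  simp_rw [hval] at key
  have hterm (n : ℕ+) : c n * (((n : ℕ) : ℂ) ^ (ν / 2)
      * besselK ν ((a * √((n : ℝ) * x) : ℝ) : ℂ))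
      = (X : ℂ) ^ (-(ν / 2)) / 2 * (c n * besselInt (n * X) ν) := by
    rw [cpow_mul_besselK ha hx]; ring
  simp_rw [hterm]
  refine ⟨key.summable.mul_left _, ?_⟩
  rw [tsum_mul_left, key.tsum_eq, show ν / 2 + k + 1 = ν / 2 + (k + 1 : ℕ) by push_cast; ring,
    Complex.cpow_add _ _ hX0, Complex.cpow_natCast, Complex.cpow_neg]
  have h1 : (X : ℂ) ^ (ν / 2) ≠ 0 := fun h => hX0 ((Complex.cpow_eq_zero_iff _ _).1 h).1
  have h2 : ∫ t in Ioi (0 : ℝ), ∑' n, F n t = ∫ t in Ioi (0 : ℝ), eulerKernel ν t *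
      ∑' n : ℕ+, c n * Complex.exp (-((X / t : ℝ) : ℂ)) ^ (n : ℕ) := by
    refine setIntegral_congr_fun measurableSet_Ioi fun t _ => ?_
    rw [← tsum_mul_left]
    refine tsum_congr fun n => ?_
    rw [← Complex.exp_nat_mul, hF]
    simp only
    push_cast
    ring_nf
  rw [h2]
  field_simp

end TermwiseIntegration

/-! ### The cosine identity: Dirichlet series form, then zeta values at -k. -/

section CosineIdentity

open MeasureTheory Set Filter

lemma hasSum_sum_divisors {g : ℕ → ℕ → ℂ} (h : Summable fun p : ℕ+ × ℕ+ => g p.1 p.2) :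
    HasSum (fun n : ℕ+ => ∑ d ∈ (n : ℕ).divisors, g d (n / d)) (∑' p : ℕ+ × ℕ+, g p.1 p.2) := by
  have h1 := (sigmaAntidiagonalEquivProd.hasSum_iff (f := fun p : ℕ+ × ℕ+ => g p.1 p.2)).2 h.hasSum
  refine h1.sigma fun n => ?_
  have h2 : ∑ d ∈ (n : ℕ).divisors, g d (n / d)
      = ∑ x : (n : ℕ).divisorsAntidiagonal, g x.1.1 x.1.2 := by
    rw [← Nat.sum_divisorsAntidiagonal (f := g),
      Finset.sum_coe_sort (n : ℕ).divisorsAntidiagonal (fun x => g x.1 x.2)]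
  rw [h2]
  exact hasSum_fintype _

lemma norm_sum_divisors_le (k : ℕ) {h : ℕ → ℂ} (hh : ∀ d, ‖h d‖ ≤ 1) (n : ℕ+) :
    ‖∑ d ∈ (n : ℕ).divisors, (d : ℂ) ^ k * h d‖ ≤ (n : ℝ) ^ (k + 1) := by
  calc _ ≤ ∑ d ∈ (n : ℕ).divisors, (n : ℝ) ^ k := by
        refine norm_sum_le_of_le _ fun d hd => ?_
        rw [norm_mul, norm_pow, Complex.norm_natCast]
        have : (d : ℝ) ≤ n := by exact_mod_cast Nat.divisor_le hd
        calc _ ≤ (n : ℝ) ^ k * 1 := by gcongr; exact hh d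
          _ = _ := mul_one _
    _ ≤ n * (n : ℝ) ^ k := by
        rw [Finset.sum_const, nsmul_eq_mul]
        gcongr
        exact_mod_cast Nat.card_divisors_le_self n
    _ = _ := by ring

lemma cosDivisorSum_eq (k : ℕ) (θ : ℝ) (n : ℕ) :
    (cosDivisorSum k θ n : ℂ)
      = ∑ d ∈ n.divisors, (d : ℂ) ^ k * (Real.cos (2 * π * ((n / d : ℕ) : ℝ) * θ) : ℂ) := by
  rw [cosDivisorSum, Complex.ofReal_sum]
  refine Finset.sum_congr rfl fun d hd => ?_
  rw [Nat.cast_div (Nat.dvd_of_mem_divisors hd)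
    (Nat.cast_ne_zero.2 (Nat.pos_of_mem_divisors hd).ne'), Complex.ofReal_mul, Complex.ofReal_pow,
    Complex.ofReal_natCast]
  congr 3
  ring

lemma tsum_cosDivisorSum (k : ℕ) (θ : ℝ) {y : ℝ} (hy : 0 < y) :
    ∑' n : ℕ+, (cosDivisorSum k θ n : ℂ) * Complex.exp (-y) ^ (n : ℕ)
      = ∑' p : ℕ+ × ℕ+, (p.1 : ℂ) ^ k * (Real.cos (2 * π * p.2 * θ) : ℂ)
        * Complex.exp (-y) ^ (p.1 * p.2 : ℕ) := by
  have hs := (hasSum_mul_lambertSum k hy (g := fun m : ℕ+ => (Real.cos (2 * π * m * θ) : ℂ))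
    (C := 1) fun m => by rw [Complex.norm_real]; exact Real.abs_cos_le_one _).1
  have h := hasSum_sum_divisors (g := fun d m : ℕ => (d : ℂ) ^ k * (Real.cos (2 * π * m * θ) : ℂ)
        * Complex.exp (-y) ^ (d * m : ℕ)) hs
  rw [← h.tsum_eq]
  refine tsum_congr fun n => ?_
  rw [cosDivisorSum_eq, Finset.sum_mul]
  refine Finset.sum_congr rfl fun d hd => ?_
  rw [Nat.mul_div_cancel' (Nat.dvd_of_mem_divisors hd)]

/-- Dropping the 1 in the denominator separates the variables into r^{-(σ+k+1)} and (m +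
θ)^{-(1+σ)}; the second factor is where σ > 0 enters. -/
lemma summable_div_add_one_rpow (k : ℕ) {σ : ℝ} (hσ : 0 < σ) {κ : ℝ} (hκ : 0 < κ) {θ : ℝ}
    (h0 : 0 < θ) : Summable fun p : ℕ+ × ℕ =>
      (p.2 + θ) ^ k / (κ * (p.1 * (p.2 + θ)) + 1) ^ (σ + k + 1) := by
  have h1 : Summable fun r : ℕ+ => ((r : ℝ) ^ (σ + k + 1))⁻¹ :=
    (summable_pnat_iff_summable_nat (f := fun r : ℕ => ((r : ℝ) ^ (σ + k + 1))⁻¹)).2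
      (Real.summable_nat_rpow_inv.2 (by linarith [k.cast_nonneg (α := ℝ)]))
  have h2 : Summable fun m : ℕ => 1 / |m + θ| ^ (1 + σ) :=
    (Real.summable_one_div_nat_add_rpow θ _).2 (by linarith)
  have h3 := (h1.mul_of_nonneg h2 (fun r => by positivity) (fun m => by positivity)).mul_left
    ((κ ^ (σ + k + 1))⁻¹)
  refine Summable.of_nonneg_of_le (fun p => by positivity) (fun p => ?_) h3
  have hu : 0 < p.2 + θ := by positivity
  have hr : (0 : ℝ) < p.1 := by exact_mod_cast p.1.pos
  have hb : (κ * (p.1 * (p.2 + θ))) ^ (σ + k + 1) ≤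
      (κ * (p.1 * (p.2 + θ)) + 1) ^ (σ + k + 1) :=
    Real.rpow_le_rpow (by positivity) (by linarith) (by positivity)
  calc _ ≤ (p.2 + θ) ^ k / (κ * (p.1 * (p.2 + θ))) ^ (σ + k + 1) := by gcongr
    _ = _ := by
      rw [Real.mul_rpow hκ.le (by positivity), Real.mul_rpow hr.le hu.le, abs_of_pos hu,
        show σ + k + 1 = (1 + σ) + k by ring, Real.rpow_add hu, Real.rpow_natCast]
      field_simp

/-- The half of `doubleTerm` attached to a single residue. -/
noncomputable def latticeTerm (k : ℕ) (ν : ℂ) (a x θ : ℝ) (p : ℕ+ × ℕ) : ℂ :=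
  ((p.2 + θ : ℝ) : ℂ) ^ k
      / ((16 * π ^ 2 / a ^ 2 * ((p.1 : ℝ) * (p.2 + θ) / x) + 1 : ℝ) : ℂ) ^ (ν + k + 1)

lemma doubleTerm_eq (k : ℕ) (ν : ℂ) (a x θ : ℝ) (p : ℕ+ × ℕ) :
    doubleTerm k ν a x θ p.1 p.2 = latticeTerm k ν a x θ p + latticeTerm k ν a x (1 - θ) p := by
  rw [doubleTerm, latticeTerm, latticeTerm, add_sub_assoc]

lemma summable_latticeTerm (k : ℕ) {ν : ℂ} (hν : 0 < ν.re) {a x : ℝ} (ha : 0 < a) (hx : 0 < x)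
    {θ : ℝ} (h0 : 0 < θ) : Summable (latticeTerm k ν a x θ) := by
  refine Summable.of_norm_bounded (summable_div_add_one_rpow k hν
    (κ := 16 * π ^ 2 / a ^ 2 / x) (by positivity) h0) fun p => le_of_eq ?_
  have hu : 0 < p.2 + θ := by positivity
  rw [latticeTerm, norm_div, norm_pow, Complex.norm_real, Real.norm_of_nonneg hu.le,
    Complex.norm_cpow_eq_rpow_re_of_pos (by positivity)]
  simp only [Complex.add_re, Complex.natCast_re, Complex.one_re]
  congr 2
  ring

/-- Since w = 4π²t/X is linear in t, each summand is a constant times e^{-At} with A = 16π² r(m +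
θ)/(a²x), and Euler's integral produces (A + 1)^{-(ν+k+1)}. -/
lemma integral_eulerKernel_mul_absPowExp {k : ℕ} (hk : 1 ≤ k) {ν : ℂ} (hν : 0 < ν.re) {a x : ℝ}
    (ha : 0 < a) (hx : 0 < x) {θ : ℝ} (h0 : 0 < θ) (h1 : θ < 1) :
    IntegrableOn (fun t : ℝ => eulerKernel (ν + k + 1) t * ∑' p : ℕ+ × ℕ,
      (absPowExp k (p.1 * (4 * π ^ 2 / (a ^ 2 * x / 4 / t))) (p.2 + θ) : ℂ)) (Ioi 0) ∧
    ∫ t in Ioi (0 : ℝ), eulerKernel (ν + k + 1) t * ∑' p : ℕ+ × ℕ,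
      (absPowExp k (p.1 * (4 * π ^ 2 / (a ^ 2 * x / 4 / t))) (p.2 + θ) : ℂ)
      = Complex.Gamma (ν + k + 1) * ∑' p, latticeTerm k ν a x θ p := by
  have hu (m : ℕ) : (0 : ℝ) < m + θ := by positivity
  set b : ℕ+ × ℕ → ℂ := fun p => ((p.2 + θ : ℝ) : ℂ) ^ k with hb
  set A : ℕ+ × ℕ → ℝ := fun p => 16 * π ^ 2 / a ^ 2 * ((p.1 : ℝ) * (p.2 + θ) / x) with hA
  have hs : 0 < (ν + k + 1).re := by
    simp only [Complex.add_re, Complex.natCast_re, Complex.one_re]; positivity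
  have hterm (t : ℝ) (ht : 0 < t) (p : ℕ+ × ℕ) :
      (absPowExp k (p.1 * (4 * π ^ 2 / (a ^ 2 * x / 4 / t))) (p.2 + θ) : ℂ)
        = b p * (Real.exp (-A p * t) : ℂ) := by
    rw [absPowExp_of_pos _ _ (hu _), hb, hA]
    push_cast
    congr 2
    field_simp
    ring
  have hsum : Summable fun p => ‖b p‖ / (A p + 1) ^ (ν + k + 1).re := by
    refine (summable_latticeTerm k hν ha hx h0).norm.congr fun p => ?_
    have := hu p.2
    rw [latticeTerm, norm_div, Complex.norm_cpow_eq_rpow_re_of_pos (by positivity)]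
  have hp : ∀ t : ℝ, 0 < t → Summable fun p => b p * (Real.exp (-A p * t) : ℂ) := by
    intro t ht
    have hw : 0 < 4 * π ^ 2 / (a ^ 2 * x / 4 / t) := by positivity
    have h2 := (hasSum_double_absPowExp hk hw h0 h1).summable
    have h3 : Summable fun p : ℕ+ × ℕ =>
        absPowExp k (p.1 * (4 * π ^ 2 / (a ^ 2 * x / 4 / t))) (p.2 + θ) :=
      Summable.of_nonneg_of_le (fun p => by unfold absPowExp; positivity)
        (fun p => le_add_of_nonneg_right (by unfold absPowExp; positivity)) h2
    exact (Complex.hasSum_ofReal.2 h3.hasSum).summable.congr fun p => (hterm t ht p)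
  obtain ⟨k1, k2⟩ := integral_eulerKernel_mul_tsum hs (fun p => by positivity [hu p.2]) hsum hp
  have heq : EqOn (fun t : ℝ => eulerKernel (ν + k + 1) t * ∑' p : ℕ+ × ℕ,
      (absPowExp k (p.1 * (4 * π ^ 2 / (a ^ 2 * x / 4 / t))) (p.2 + θ) : ℂ))
      (fun t => eulerKernel (ν + k + 1) t * ∑' p, b p * (Real.exp (-A p * t) : ℂ)) (Ioi 0) :=
    fun t ht => by
      simp only
      congr 1
      exact tsum_congr fun p => hterm t ht p
  exact ⟨(integrableOn_congr_fun heq measurableSet_Ioi).2 k1,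
    (setIntegral_congr_fun measurableSet_Ioi heq).trans k2⟩


/-- The cosine identity, with the constant terms given by convergent Dirichlet series. -/
theorem cosIdentity_dirichlet {k : ℕ} (hk : Odd k) {ν : ℂ} (hν : 0 < ν.re) {a x : ℝ} (ha : 0 < a)
    (hx : 0 < x) {θ : ℝ} (h0 : 0 < θ) (h1 : θ < 1) :
    Summable (fun n : ℕ+ => (cosDivisorSum k θ n : ℂ) * (((n : ℕ) : ℂ) ^ (ν / 2)
      * besselK ν ((a * √((n : ℝ) * x) : ℝ) : ℂ))) ∧
    ((a ^ 2 * x / 4 : ℝ) : ℂ) ^ (ν / 2 + k + 1)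
      * ∑' n : ℕ+, (cosDivisorSum k θ n : ℂ) * (((n : ℕ) : ℂ) ^ (ν / 2)
        * besselK ν ((a * √((n : ℝ) * x) : ℝ) : ℂ))
    = (-1) ^ ((k + 1) / 2) * (2 * (π : ℂ)) ^ (k + 1) / 4 * Complex.Gamma (ν + k + 1)
        * (∑' p, latticeTerm k ν a x θ p + ∑' p, latticeTerm k ν a x (1 - θ) p)
      + k.factorial / 2 * Complex.Gamma (ν + k + 1)
        * ∑' m : ℕ+, (Real.cos (2 * π * m * θ) : ℂ) / (m : ℂ) ^ (k + 1)
      - ((a ^ 2 * x / 4 : ℝ) : ℂ) ^ (k + 1) / 2 * ((-1) ^ ((k + 1) / 2) * k.factorial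
        * riemannZeta (k + 1) / (2 * π : ℂ) ^ (k + 1)) * Complex.Gamma ν := by
  have hc (n : ℕ+) : ‖(cosDivisorSum k θ n : ℂ)‖ ≤ (n : ℝ) ^ (k + 1) := by
    rw [cosDivisorSum_eq]
    exact norm_sum_divisors_le k (h := fun d =>
      (Real.cos (2 * π * (((n : ℕ) / d : ℕ) : ℝ) * θ) : ℂ)) (fun d => by
        rw [Complex.norm_real]; exact Real.abs_cos_le_one _) n
  obtain ⟨hs, heq⟩ := tsum_besselK (k := k) hν ha hx hc
  refine ⟨hs, ?_⟩
  rw [heq]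
  obtain ⟨i1, v1⟩ := integral_eulerKernel_mul_absPowExp hk.pos hν ha hx h0 h1
  obtain ⟨i2, v2⟩ := integral_eulerKernel_mul_absPowExp hk.pos hν ha hx (θ := 1 - θ)
    (by linarith) (by linarith)
  set X := a ^ 2 * x / 4 with hXdef
  have hX : 0 < X := by positivity
  have hX0 : (X : ℂ) ≠ 0 := by exact_mod_cast hX.ne'
  have hsre : 0 < (ν + k + 1).re := by
    simp only [Complex.add_re, Complex.natCast_re, Complex.one_re]; positivity
  set e : ℂ := (-1) ^ ((k + 1) / 2)
  set C := ∑' m : ℕ+, (Real.cos (2 * π * m * θ) : ℂ) / (m : ℂ) ^ (k + 1)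
  set Z := e * k.factorial * riemannZeta (k + 1) / (2 * π : ℂ) ^ (k + 1)
  -- The transformation formula at y = X/t. Factors y^{-k-1} = (t/X)^{k+1} raise the order of the
  -- kernel from ν to ν + k + 1, while the constant Z keeps order ν; hence Γ(ν + k + 1) and Γ(ν)
  -- respectively.
  have hpt : EqOn (fun t : ℝ => eulerKernel ν t *
      ∑' n : ℕ+, (cosDivisorSum k θ n : ℂ) * Complex.exp (-((X / t : ℝ) : ℂ)) ^ (n : ℕ))
      (fun t => ((e * (2 * π) ^ (k + 1) / 2 / (X : ℂ) ^ (k + 1)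
          * (eulerKernel (ν + k + 1) t * (∑' p : ℕ+ × ℕ,
            (absPowExp k (p.1 * (4 * π ^ 2 / (X / t))) (p.2 + θ) : ℂ)))
        + e * (2 * π) ^ (k + 1) / 2 / (X : ℂ) ^ (k + 1)
          * (eulerKernel (ν + k + 1) t * (∑' p : ℕ+ × ℕ,
            (absPowExp k (p.1 * (4 * π ^ 2 / (X / t))) (p.2 + (1 - θ)) : ℂ))))
        + k.factorial / (X : ℂ) ^ (k + 1) * C * eulerKernel (ν + k + 1) t)
        - Z * eulerKernel ν t) (Ioi 0) := by
    intro t ht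
    have ht : 0 < t := ht
    have ht0 : (t : ℂ) ≠ 0 := by exact_mod_cast ht.ne'
    have hy : 0 < X / t := by positivity
    have hker : eulerKernel (ν + k + 1) t = eulerKernel ν t * (t : ℂ) ^ (k + 1) := by
      rw [← Complex.cpow_natCast, eulerKernel_mul_cpow _ _ ht]
      push_cast
      ring_nf
    have hsummable (φ : ℝ) (hφ0 : 0 < φ) (hφ1 : φ < 1) : Summable fun p : ℕ+ × ℕ =>
        (absPowExp k (p.1 * (4 * π ^ 2 / (X / t))) (p.2 + φ) : ℂ) := by
      have h2 := (hasSum_double_absPowExp hk.pos (w := 4 * π ^ 2 / (X / t)) (by positivity)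
        hφ0 hφ1).summable
      have h3 : Summable fun p : ℕ+ × ℕ =>
          absPowExp k (p.1 * (4 * π ^ 2 / (X / t))) (p.2 + φ) :=
        Summable.of_nonneg_of_le (fun p => by unfold absPowExp; positivity)
          (fun p => le_add_of_nonneg_right (by unfold absPowExp; positivity)) h2
      exact (Complex.hasSum_ofReal.2 h3.hasSum).summable
    have hG : ∑' p : ℕ+ × ℕ, ((absPowExp k (p.1 * (4 * π ^ 2 / (X / t))) (p.2 + θ)
            + absPowExp k (p.1 * (4 * π ^ 2 / (X / t))) (p.2 + 1 - θ) : ℝ) : ℂ)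
        = ∑' p : ℕ+ × ℕ, (absPowExp k (p.1 * (4 * π ^ 2 / (X / t))) (p.2 + θ) : ℂ)
          + ∑' p : ℕ+ × ℕ, (absPowExp k (p.1 * (4 * π ^ 2 / (X / t))) (p.2 + (1 - θ)) : ℂ) := by
      rw [← (hsummable θ h0 h1).tsum_add (hsummable (1 - θ) (by linarith) (by linarith))]
      refine tsum_congr fun p => ?_
      push_cast
      rw [add_sub_assoc]
    have hdiv : (2 * π / ((X / t : ℝ) : ℂ)) ^ (k + 1)
        = (2 * π) ^ (k + 1) * (t : ℂ) ^ (k + 1) / (X : ℂ) ^ (k + 1) := by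
      rw [← mul_pow, ← div_pow]
      push_cast
      congr 1
      field_simp
    have hdiv2 : ((X / t : ℝ) : ℂ) ^ (k + 1) = (X : ℂ) ^ (k + 1) / (t : ℂ) ^ (k + 1) := by
      rw [← div_pow]; push_cast; rfl
    simp only
    rw [tsum_cosDivisorSum k θ hy, lambert_cos_transformation hk hy h0 h1, hG, hdiv, hdiv2, hker]
    generalize ∑' p : ℕ+ × ℕ, (absPowExp k (p.1 * (4 * π ^ 2 / (X / t))) (p.2 + θ) : ℂ) = G1
    generalize ∑' p : ℕ+ × ℕ, (absPowExp k (p.1 * (4 * π ^ 2 / (X / t))) (p.2 + (1 - θ)) : ℂ) = G2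
    change eulerKernel ν t * (e * ((2 * π) ^ (k + 1) * (t : ℂ) ^ (k + 1) / (X : ℂ) ^ (k + 1)) / 2
      * (G1 + G2) - Z + k.factorial / ((X : ℂ) ^ (k + 1) / (t : ℂ) ^ (k + 1)) * C) = _
    field_simp
    ring
  have j1 := i1.const_mul (e * (2 * π) ^ (k + 1) / 2 / (X : ℂ) ^ (k + 1))
  have j2 := i2.const_mul (e * (2 * π) ^ (k + 1) / 2 / (X : ℂ) ^ (k + 1))
  have j3 := (integrableOn_eulerKernel hsre).const_mul (k.factorial / (X : ℂ) ^ (k + 1) * C)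
  have j4 := (integrableOn_eulerKernel hν).const_mul Z
  have e1 := integral_sub ((j1.add j2).add j3) j4
  have e2 := integral_add (j1.add j2) j3
  have e3 := integral_add j1 j2
  simp only [Pi.add_apply] at e1 e2 e3
  rw [setIntegral_congr_fun measurableSet_Ioi hpt, e1, e2, e3, integral_const_mul, integral_const_mul,
    integral_const_mul, integral_const_mul, v1, v2, integral_eulerKernel hsre,
    integral_eulerKernel hν]
  field_simp
  ring

lemma cos_pi_mul_half_of_odd {k : ℕ} (hk : Odd k) :
    Complex.cos (π * ((k : ℂ) + 1) / 2) = (-1) ^ ((k + 1) / 2) := by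
  obtain ⟨j, rfl⟩ := hk
  rw [show (2 * j + 1 + 1) / 2 = j + 1 by omega]
  have h : (π : ℂ) * ((2 * j + 1 : ℕ) + 1) / 2 = 0 + (j + 1 : ℕ) * π := by push_cast; ring
  rw [h, Complex.cos_antiperiodic.add_nat_mul_eq, Complex.cos_zero, mul_one]

lemma two_pi_cpow_neg (k : ℕ) :
    (2 * (π : ℂ)) ^ (-((k : ℂ) + 1)) = ((2 * (π : ℂ)) ^ (k + 1))⁻¹ := by
  rw [Complex.cpow_neg, show (k : ℂ) + 1 = ((k + 1 : ℕ) : ℂ) by push_cast; rfl,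
    Complex.cpow_natCast]

lemma natCast_add_one_ne_neg (k n : ℕ) : (k : ℂ) + 1 ≠ -n := by
  intro h
  have : ((k + 1 + n : ℕ) : ℂ) = 0 := by push_cast; rw [h]; ring
  exact absurd (Nat.cast_eq_zero.1 this) (by omega)

lemma riemannZeta_neg_of_odd {k : ℕ} (hk : Odd k) :
    riemannZeta (-(k : ℂ)) = 2 * (-1) ^ ((k + 1) / 2) * k.factorial * riemannZeta (k + 1)
      / (2 * π : ℂ) ^ (k + 1) := by
  have h1 : (k : ℂ) + 1 ≠ 1 := by simpa using hk.pos.ne'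
  have h := riemannZeta_one_sub (natCast_add_one_ne_neg k) h1
  rw [show 1 - ((k : ℂ) + 1) = -k by ring, two_pi_cpow_neg, Complex.Gamma_nat_eq_factorial,
    cos_pi_mul_half_of_odd hk] at h
  rw [h]
  ring

/-- The sum over θ and 1 - θ ≡ -θ is twice the even Hurwitz zeta function, whose functional equation
leads to the cosine zeta function at k + 1, inside its region of convergence. -/
lemma hurwitzZeta_add_one_sub_of_odd {k : ℕ} (hk : Odd k) (θ : ℝ) :
    HurwitzZeta.hurwitzZeta ((θ : ℝ) : UnitAddCircle) (-(k : ℂ))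
        + HurwitzZeta.hurwitzZeta ((1 - θ : ℝ) : UnitAddCircle) (-(k : ℂ))
      = 4 * (-1) ^ ((k + 1) / 2) * k.factorial / (2 * π : ℂ) ^ (k + 1)
        * ∑' m : ℕ+, (Real.cos (2 * π * m * θ) : ℂ) / (m : ℂ) ^ (k + 1) := by
  have h1 : (k : ℂ) + 1 ≠ 1 := by simpa using hk.pos.ne'
  have hneg : ((1 - θ : ℝ) : UnitAddCircle) = -((θ : ℝ) : UnitAddCircle) := by
    rw [AddCircle.coe_sub, AddCircle.coe_period, zero_sub]
  have h := HurwitzZeta.hurwitzZetaEven_one_sub ((θ : ℝ) : UnitAddCircle)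
    (natCast_add_one_ne_neg k) (Or.inr h1)
  have hre : 1 < ((k : ℂ) + 1).re := by
    simp only [Complex.add_re, Complex.natCast_re, Complex.one_re]
    have : (0 : ℝ) < k := by exact_mod_cast hk.pos
    linarith
  have hc := (HurwitzZeta.hasSum_nat_cosZeta θ hre).tsum_eq
  rw [← tsum_pnat_eq_tsum_of_eq_zero (f := fun n : ℕ =>
    (Real.cos (2 * π * θ * n) : ℂ) / (n : ℂ) ^ ((k : ℂ) + 1)) (by
      simp only [Nat.cast_zero]
      rw [Complex.zero_cpow (fun h => by rw [h] at hre; simp at hre; linarith),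
        div_zero])] at hc
  rw [show 1 - ((k : ℂ) + 1) = -k by ring, two_pi_cpow_neg, Complex.Gamma_nat_eq_factorial,
    cos_pi_mul_half_of_odd hk, ← hc, HurwitzZeta.hurwitzZetaEven_eq, ← hneg] at h
  have hcongr : ∑' n : ℕ+, (Real.cos (2 * π * θ * n) : ℂ) / (n : ℂ) ^ ((k : ℂ) + 1)
      = ∑' m : ℕ+, (Real.cos (2 * π * m * θ) : ℂ) / (m : ℂ) ^ (k + 1) := by
    refine tsum_congr fun m => ?_
    rw [show (k : ℂ) + 1 = ((k + 1 : ℕ) : ℂ) by push_cast; rfl, Complex.cpow_natCast,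
      mul_right_comm]
  rw [hcongr] at h
  linear_combination 2 * h

theorem cosIdentity_of_odd {k : ℕ} (hk : Odd k) {ν : ℂ} (hν : 0 < ν.re) {a x : ℝ} (ha : 0 < a)
    (hx : 0 < x) {θ : ℝ} (h0 : 0 < θ) (h1 : θ < 1) : CosIdentity k ν a x θ := by
  obtain ⟨hs, heq⟩ := cosIdentity_dirichlet hk hν ha hx h0 h1
  have hl1 := summable_latticeTerm k hν ha hx h0
  have hl2 := summable_latticeTerm k hν ha hx (θ := 1 - θ) (by linarith)
  have hd : Summable (fun p : ℕ+ × ℕ => doubleTerm k ν a x θ p.1 p.2) :=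
    (hl1.add hl2).congr fun p => (doubleTerm_eq k ν a x θ p).symm
  refine ⟨hs.congr fun n => mul_comm _ _, hd, ?_⟩
  have e1 : ∑' n : ℕ+, ((n : ℕ) : ℂ) ^ (ν / 2) * besselK ν ((a * √((n : ℝ) * x) : ℝ) : ℂ)
          * (cosDivisorSum k θ n : ℂ) = ∑' n : ℕ+, (cosDivisorSum k θ n : ℂ) *
        (((n : ℕ) : ℂ) ^ (ν / 2) * besselK ν ((a * √((n : ℝ) * x) : ℝ) : ℂ)) :=
    tsum_congr fun n => mul_comm _ _
  have e2 : ∑' r : ℕ+, ∑' m : ℕ, doubleTerm k ν a x θ r m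
      = ∑' p, latticeTerm k ν a x θ p + ∑' p, latticeTerm k ν a x (1 - θ) p := by
    rw [← hl1.tsum_add hl2, ← hd.tsum_prod]
    exact tsum_congr fun p => doubleTerm_eq k ν a x θ p
  have e3 : (a : ℂ) ^ (2 * k + 2) / 2 ^ (2 * k + 4) * (x : ℂ) ^ (k + 1)
      = ((a ^ 2 * x / 4 : ℝ) : ℂ) ^ (k + 1) / 4 := by
    push_cast
    rw [div_pow, mul_pow, ← pow_mul, show 2 * (k + 1) = 2 * k + 2 by ring,
      show (4 : ℂ) = 2 ^ 2 by norm_num, ← pow_mul, show 2 * k + 4 = 2 * (k + 1) + 2 by ring,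
      pow_add (2 : ℂ) (2 * (k + 1)) 2]
    field_simp
  rw [e1, heq, e2, hurwitzZeta_add_one_sub_of_odd hk, riemannZeta_neg_of_odd hk]
  have hu : (-1 : ℂ) ^ ((k + 1) / 2) * (-1) ^ ((k + 1) / 2) = 1 := by
    rw [← mul_pow]; norm_num
  have hpi : (2 * π : ℂ) ^ (k + 1) * ((2 * π : ℂ) ^ (k + 1))⁻¹ = 1 :=
    mul_inv_cancel₀ (pow_ne_zero _ (by simp [Real.pi_ne_zero]))
  generalize (2 * π : ℂ) ^ (k + 1) = P at *
  generalize (-1 : ℂ) ^ ((k + 1) / 2) = e at *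
  generalize ∑' m : ℕ+, (Real.cos (2 * π * m * θ) : ℂ) / (m : ℂ) ^ (k + 1) = C
  linear_combination (2 * e * k.factorial * riemannZeta (k + 1) / P * Complex.Gamma ν) * e3
    - (k.factorial / 2 * Complex.Gamma (ν + k + 1) * C) * (hu + e * e * hpi)

end CosineIdentity

/-! ### Gauss sums of primitive even characters and twisted series. -/

section CharacterSums

open scoped ComplexConjugate

lemma inv_apply_eq_conj {q : ℕ} (χ : DirichletCharacter ℂ q) (b : ZMod q) : χ⁻¹ b = conj (χ b) := by
  rw [← MulChar.star_eq_inv, MulChar.star_apply]; rfl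

lemma sum_inv_mul_conj_stdAddChar {q : ℕ} [NeZero q] {χ : DirichletCharacter ℂ q} (hχ : χ.IsPrimitive) (m : ZMod q) :
    ∑ h, χ⁻¹ h * conj (ZMod.stdAddChar (m * h)) = χ m * conj (gaussSum χ ZMod.stdAddChar) := by
  have h := congrArg conj (gaussSum_mulShift_of_isPrimitive ZMod.stdAddChar hχ m)
  rw [gaussSum, map_sum, map_mul, inv_apply_eq_conj, Complex.conj_conj] at h
  rw [← h]
  refine Finset.sum_congr rfl fun b _ => ?_
  rw [AddChar.mulShift_apply, map_mul (starRingEnd ℂ), inv_apply_eq_conj]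

/-- Primitivity lets the conjugate Gauss sum absorb χ(b); orthogonality in b of the additive
characters b ↦ e(b(1 - h)) then isolates h = 1. -/
lemma gaussSum_mul_conj {q : ℕ} [NeZero q] {χ : DirichletCharacter ℂ q} (hχ : χ.IsPrimitive) :
    gaussSum χ ZMod.stdAddChar * conj (gaussSum χ ZMod.stdAddChar) = q := by
  have h1 : gaussSum χ ZMod.stdAddChar * conj (gaussSum χ ZMod.stdAddChar)
      = ∑ b : ZMod q, ∑ h : ZMod q, χ⁻¹ h * ZMod.stdAddChar (b * (1 - h)) := by
    conv_lhs => rw [gaussSum, Finset.sum_mul]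
    refine Finset.sum_congr rfl fun b _ => ?_
    rw [mul_right_comm, ← gaussSum, ← sum_inv_mul_conj_stdAddChar hχ, Finset.sum_mul]
    refine Finset.sum_congr rfl fun h _ => ?_
    rw [mul_sub, mul_one, sub_eq_add_neg, AddChar.map_add_eq_mul, AddChar.map_neg_eq_conj]
    ring
  rw [h1, Finset.sum_comm, Finset.sum_eq_single 1]
  · rw [← Finset.mul_sum, AddChar.sum_mulShift _ (ZMod.isPrimitive_stdAddChar q)]
    simp
  · intro h _ hh
    rw [← Finset.mul_sum, AddChar.sum_mulShift _ (ZMod.isPrimitive_stdAddChar q),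
      if_neg (sub_ne_zero.2 hh.symm)]
    simp
  · simp

lemma cos_eq_stdAddChar {q : ℕ} [NeZero q] (n : ℕ) (h : ZMod q) :
    (Real.cos (2 * π * n * (h.val / q)) : ℂ)
      = (ZMod.stdAddChar ((n : ZMod q) * h) + conj (ZMod.stdAddChar ((n : ZMod q) * h))) / 2 := by
  have h1 : (n : ZMod q) * h = ((n * h.val : ℤ) : ZMod q) := by
    push_cast; rw [ZMod.natCast_zmod_val]
  rw [h1, ZMod.stdAddChar_coe, ← Complex.exp_conj, Complex.ofReal_cos, Complex.cos]
  have h2 : conj (2 * π * Complex.I * ((n * h.val : ℤ) : ℂ) / q)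
      = -(2 * π * Complex.I * ((n * h.val : ℤ) : ℂ) / q) := by
    have h3 : 2 * π * Complex.I * ((n * h.val : ℤ) : ℂ) / q
        = ((2 * π * (n * h.val) / q : ℝ) : ℂ) * Complex.I := by push_cast; ring
    rw [h3, map_mul, Complex.conj_ofReal, Complex.conj_I, mul_neg]
  rw [h2]
  push_cast
  ring_nf

/-- For even χ the substitution h ↦ -h shows that both exponentials of the cosine give the same
twisted Gauss sum. -/
lemma sum_inv_mul_cos {q : ℕ} [NeZero q] {χ : DirichletCharacter ℂ q} (hχ : χ.IsPrimitive) (he : χ.Even) (n : ℕ) :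
    ∑ h : ZMod q, χ⁻¹ h * (Real.cos (2 * π * n * (h.val / q)) : ℂ)
      = χ n * conj (gaussSum χ ZMod.stdAddChar) := by
  have h1 := sum_inv_mul_conj_stdAddChar hχ (n : ZMod q)
  have h2 : ∑ h : ZMod q, χ⁻¹ h * ZMod.stdAddChar ((n : ZMod q) * h)
      = χ n * conj (gaussSum χ ZMod.stdAddChar) := by
    rw [← h1]
    refine Fintype.sum_equiv (Equiv.neg _) _ _ fun h => ?_
    rw [Equiv.neg_apply, mul_neg, AddChar.map_neg_eq_conj, Complex.conj_conj, inv_apply_eq_conj,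
      inv_apply_eq_conj, DirichletCharacter.Even.eval_neg _ _ he]
  simp_rw [cos_eq_stdAddChar, mul_div_assoc', mul_add]
  rw [← Finset.sum_div, Finset.sum_add_distrib, h1, h2]
  ring

lemma sum_inv_mul_cosDivisorSum {q : ℕ} [NeZero q] {χ : DirichletCharacter ℂ q} (hχ : χ.IsPrimitive) (he : χ.Even)
    (k n : ℕ) : ∑ h : ZMod q, χ⁻¹ h * (cosDivisorSum k (h.val / q) n : ℂ)
      = sigmaBarChi k χ n * conj (gaussSum χ ZMod.stdAddChar) := by
  simp_rw [cosDivisorSum_eq, Finset.mul_sum]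
  rw [Finset.sum_comm, sigmaBarChi, Finset.sum_mul]
  refine Finset.sum_congr rfl fun d _ => ?_
  rw [mul_assoc ((d : ℂ) ^ k), ← sum_inv_mul_cos hχ he, Finset.mul_sum]
  exact Finset.sum_congr rfl fun h _ => by ring

lemma LFunction_one_add_natCast {q : ℕ} [NeZero q] (χ : DirichletCharacter ℂ q) {k : ℕ} (hk : 1 ≤ k) :
    DirichletCharacter.LFunction χ (1 + k) = ∑' m : ℕ+, χ (m : ℕ) / (m : ℂ) ^ (k + 1) := by
  have hre : 1 < (1 + k : ℂ).re := by
    simp only [Complex.add_re, Complex.natCast_re, Complex.one_re]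
    have : (1 : ℝ) ≤ k := by exact_mod_cast hk
    linarith
  rw [DirichletCharacter.LFunction_eq_LSeries χ hre, LSeries,
    ← tsum_pnat_eq_tsum_of_eq_zero (f := fun n => LSeries.term (χ ·) (1 + k) n)
      (LSeries.term_zero _ _)]
  refine tsum_congr fun m => ?_
  rw [LSeries.term_of_ne_zero m.ne_zero, show (1 : ℂ) + k = ((k + 1 : ℕ) : ℂ) by push_cast; ring,
    Complex.cpow_natCast]

lemma summable_twisted_lattice {q : ℕ} (χ : DirichletCharacter ℂ q) (k : ℕ) {ν : ℂ} (hν : 0 < ν.re)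
    {κ : ℝ} (hκ : 0 < κ) : Summable fun p : ℕ+ × ℕ+ =>
      (p.1 : ℂ) ^ k * χ (p.1 : ℕ) / ((κ * (p.1 * p.2) + 1 : ℝ) : ℂ) ^ (ν + k + 1) := by
  -- At shift θ = 1 the points m + θ run over the positive integers.
  have h := summable_div_add_one_rpow k hν hκ one_pos
  have h2 := ((Equiv.prodComm ℕ+ ℕ+).trans
    ((Equiv.refl ℕ+).prodCongr Equiv.pnatEquivNat)).summable_iff.2 h
  refine Summable.of_norm_bounded h2 fun p => ?_
  have hp : ((Equiv.pnatEquivNat p.1 : ℕ) : ℝ) + 1 = p.1 := by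
    exact_mod_cast PNat.natPred_add_one p.1
  simp only [Function.comp_apply, Equiv.trans_apply, Equiv.prodComm_apply, Equiv.prodCongr_apply,
    Prod.map_apply, Prod.swap, Equiv.refl_apply, hp]
  rw [norm_div, norm_mul, norm_pow, Complex.norm_natCast,
    Complex.norm_cpow_eq_rpow_re_of_pos (by positivity)]
  simp only [Complex.add_re, Complex.natCast_re, Complex.one_re]
  rw [mul_comm (p.1 : ℝ) p.2]
  gcongr
  exact mul_le_of_le_one_right (by positivity) (χ.norm_le_one _)

lemma hasSum_sigmaChi {q : ℕ} (χ : DirichletCharacter ℂ q) (k : ℕ) {ν : ℂ} (hν : 0 < ν.re)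
    {κ : ℝ} (hκ : 0 < κ) : HasSum (fun n : ℕ+ =>
      sigmaChi k χ n / ((κ * n + 1 : ℝ) : ℂ) ^ (ν + k + 1))
      (∑' p : ℕ+ × ℕ+, (p.1 : ℂ) ^ k * χ (p.1 : ℕ)
        / ((κ * (p.1 * p.2) + 1 : ℝ) : ℂ) ^ (ν + k + 1)) := by
  refine (hasSum_sum_divisors (g := fun d r : ℕ => (d : ℂ) ^ k * χ (d : ℕ)
    / ((κ * (d * r) + 1 : ℝ) : ℂ) ^ (ν + k + 1))
    (summable_twisted_lattice χ k hν hκ)).congr_fun fun n => ?_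
  rw [sigmaChi, Finset.sum_div]
  refine Finset.sum_congr rfl fun d hd => ?_
  have : (d : ℝ) * ((n / d : ℕ) : ℝ) = n := by
    exact_mod_cast Nat.mul_div_cancel' (Nat.dvd_of_mem_divisors hd)
  rw [this]

end CharacterSums

/-! ### The character identity by averaging over θ = h/q. -/

section CharacterIdentity

open scoped ComplexConjugate

/-- Writing m + h/q = j/q with j = h + qm, the pairs (h, m) enumerate the naturals by residue class
and χ(h) = χ(j). Grouping by n = rj yields the divisor sums, and the numerators contribute q^{-k}.
-/
lemma sum_mul_tsum_latticeTerm {q : ℕ} [NeZero q] {χ : DirichletCharacter ℂ q} (h0 : χ 0 = 0)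
    (k : ℕ) {ν : ℂ} (hν : 0 < ν.re) {a x : ℝ} (ha : 0 < a) (hx : 0 < x) :
    ∑ h : ZMod q, χ h * ∑' p, latticeTerm k ν a x (h.val / q) p
      = ((q : ℂ) ^ k)⁻¹ * ∑' n : ℕ+, sigmaChi k χ n
        / ((16 * π ^ 2 / (a ^ 2 * q) * ((n : ℝ) / x) + 1 : ℝ) : ℂ) ^ (ν + k + 1) := by
  have hq : (0 : ℝ) < q := by exact_mod_cast Nat.pos_of_ne_zero (NeZero.ne q)
  have hq0 : (q : ℂ) ≠ 0 := by exact_mod_cast hq.ne'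
  set κ := 16 * π ^ 2 / (a ^ 2 * q) / x with hκdef
  have hκ : 0 < κ := by positivity
  set g : ℕ+ → ℕ → ℂ := fun r j => ((q : ℂ) ^ k)⁻¹ *
    ((j : ℂ) ^ k * χ j / ((κ * (j * r) + 1 : ℝ) : ℂ) ^ (ν + k + 1)) with hg
  have hs := (summable_twisted_lattice χ k hν hκ).mul_left ((q : ℂ) ^ k)⁻¹
  have hs' : Summable fun p : ℕ+ × ℕ+ => g p.1 p.2 :=
    (Equiv.prodComm ℕ+ ℕ+).summable_iff.2 hs
  have hgr (r : ℕ+) : Summable (g r) :=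
    summable_pnat_iff_summable_nat.1 (hs'.prod_factor r)
  have hLT (h : ZMod q) (p : ℕ+ × ℕ) :
      χ h * latticeTerm k ν a x (h.val / q) p = g p.1 (h.val + q * p.2) := by
    have e1 : ((h.val + q * p.2 : ℕ) : ZMod q) = h := by
      push_cast; rw [ZMod.natCast_zmod_val]; simp
    have e2 : (p.2 + h.val / q : ℝ) = ((h.val + q * p.2 : ℕ) : ℝ) / q := by
      push_cast; field_simp; ring
    rw [latticeTerm, e2, hg]
    simp only [e1]
    have e3 : 16 * π ^ 2 / a ^ 2 * ((p.1 : ℝ) * (((h.val + q * p.2 : ℕ) : ℝ) / q) / x) + 1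
        = κ * (((h.val + q * p.2 : ℕ) : ℝ) * p.1) + 1 := by
      rw [hκdef]; field_simp
    rw [e3, Complex.ofReal_div, div_pow, Complex.ofReal_natCast, Complex.ofReal_natCast]
    ring
  -- At h = 0 the shift is 0 and the convergence lemma does not apply; the weight χ(0) = 0 removes
  -- this class.
  have hsh (h : ZMod q) : Summable fun p => χ h * latticeTerm k ν a x (h.val / q) p := by
    rcases eq_or_ne h 0 with rfl | hh
    · simp [h0, summable_zero]
    · have : 0 < h.val := Nat.pos_of_ne_zero ((ZMod.val_ne_zero h).2 hh)
      exact (summable_latticeTerm k hν ha hx (by positivity)).mul_left _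
  have hsum : ∑' n : ℕ+, sigmaChi k χ n
        / ((16 * π ^ 2 / (a ^ 2 * q) * ((n : ℝ) / x) + 1 : ℝ) : ℂ) ^ (ν + k + 1)
      = ∑' p : ℕ+ × ℕ+, (p.1 : ℂ) ^ k * χ (p.1 : ℕ)
        / ((κ * (p.1 * p.2) + 1 : ℝ) : ℂ) ^ (ν + k + 1) := by
    rw [← (hasSum_sigmaChi χ k hν hκ).tsum_eq]
    refine tsum_congr fun n => ?_
    rw [hκdef]
    congr 3
    ring
  rw [hsum, ← tsum_mul_left]
  calc _ = ∑ h : ZMod q, ∑' p, χ h * latticeTerm k ν a x (h.val / q) p := by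
        simp_rw [tsum_mul_left]
    _ = ∑ h : ZMod q, ∑' r : ℕ+, ∑' m : ℕ, g r (h.val + q * m) := by
        refine Finset.sum_congr rfl fun h _ => ?_
        rw [(hsh h).tsum_prod]
        exact tsum_congr fun r => tsum_congr fun m => hLT h (r, m)
    _ = ∑' r : ℕ+, ∑ h : ZMod q, ∑' m : ℕ, g r (h.val + q * m) := by
        refine (Summable.tsum_finsetSum fun h _ => ?_).symm
        exact (hsh h).prod.congr fun r => tsum_congr fun m => hLT h (r, m)
    _ = ∑' r : ℕ+, ∑' j : ℕ+, g r j := by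
        refine tsum_congr fun r => ?_
        rw [← Nat.sumByResidueClasses (hgr r) q, ← tsum_pnat_eq_tsum_of_eq_zero]
        simp [hg, h0]
    _ = ∑' p : ℕ+ × ℕ+, g p.1 p.2 := hs'.tsum_prod.symm
    _ = _ := by
        rw [← (Equiv.prodComm ℕ+ ℕ+).tsum_eq]
        rfl

theorem charIdentity_of_odd {k : ℕ} (hk : Odd k) {ν : ℂ} (hν : 0 < ν.re) {a x : ℝ} (ha : 0 < a)
    (hx : 0 < x) {q : ℕ} [NeZero q] {χ : DirichletCharacter ℂ q} (hχ : χ.IsPrimitive)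
    (hne : χ ≠ 1) (he : χ.Even) : CharIdentity k ν a x χ := by
  have hq1 : 1 < q := by
    by_contra hq
    have : q = 1 := by have := NeZero.ne q; omega
    subst this
    exact hne (DirichletCharacter.level_one χ)
  have : Fact (1 < q) := ⟨hq1⟩
  have hq : (0 : ℝ) < q := by exact_mod_cast Nat.pos_of_ne_zero (NeZero.ne q)
  have hq0 : (q : ℂ) ≠ 0 := by exact_mod_cast hq.ne'
  have hz : χ⁻¹ 0 = 0 := MulChar.map_zero _
  set τ := gaussSum χ ZMod.stdAddChar with hτ
  have hττ : τ * conj τ = q := gaussSum_mul_conj hχ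
  have hτc : conj τ ≠ 0 := fun h => hq0 (by rw [← hττ, h, mul_zero])
  set B : ℕ+ → ℂ := fun n => ((n : ℕ) : ℂ) ^ (ν / 2) * besselK ν ((a * √((n : ℝ) * x) : ℝ) : ℂ)
    with hB
  set X : ℂ := ((a ^ 2 * x / 4 : ℝ) : ℂ)
  set L : ZMod q → ℂ := fun h => ∑' p, latticeTerm k ν a x (h.val / q) p with hL
  set C : ZMod q → ℂ := fun h =>
    ∑' m : ℕ+, (Real.cos (2 * π * m * (h.val / q)) : ℂ) / (m : ℂ) ^ (k + 1) with hC
  set c1 : ℂ := (-1) ^ ((k + 1) / 2) * (2 * (π : ℂ)) ^ (k + 1) / 4 * Complex.Gamma (ν + k + 1)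
  set c2 : ℂ := k.factorial / 2 * Complex.Gamma (ν + k + 1)
  set c3 : ℂ := X ^ (k + 1) / 2 * ((-1) ^ ((k + 1) / 2) * k.factorial
        * riemannZeta (k + 1) / (2 * π : ℂ) ^ (k + 1)) * Complex.Gamma ν
  -- The cosine identity at θ = h/q, weighted by χ̄(h). The reflected shift 1 - h/q is that of -h,
  -- and at h = 0 every term vanishes.
  have hterm (h : ZMod q) :
      Summable (fun n : ℕ+ => χ⁻¹ h * ((cosDivisorSum k (h.val / q) n : ℂ) * B n)) ∧
      X ^ (ν / 2 + k + 1) * ∑' n : ℕ+, χ⁻¹ h * ((cosDivisorSum k (h.val / q) n : ℂ) * B n)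
        = c1 * (χ⁻¹ h * L h + χ⁻¹ h * L (-h)) + c2 * (χ⁻¹ h * C h) - c3 * χ⁻¹ h := by
    rcases eq_or_ne h 0 with rfl | hh
    · simp [hz, summable_zero]
    · have hv : 0 < h.val := Nat.pos_of_ne_zero ((ZMod.val_ne_zero h).2 hh)
      have hlt : (h.val : ℝ) < q := by exact_mod_cast ZMod.val_lt h
      obtain ⟨h1, h2⟩ := cosIdentity_dirichlet hk hν ha hx (θ := h.val / q) (by positivity)
        ((div_lt_one hq).2 hlt)
      refine ⟨h1.mul_left _, ?_⟩
      have hneg : 1 - (h.val : ℝ) / q = ((-h).val : ℝ) / q := by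
        rw [ZMod.neg_val, if_neg hh, Nat.cast_sub (ZMod.val_lt h).le]
        field_simp
      rw [tsum_mul_left, mul_left_comm, h2, hneg]
      ring
  have hcoef (n : ℕ+) : sigmaBarChi k χ n * ((n : ℕ) : ℂ) ^ (ν / 2)
        * besselK ν ((a * √((n : ℝ) * x) : ℝ) : ℂ)
      = (conj τ)⁻¹ * ∑ h : ZMod q, χ⁻¹ h * ((cosDivisorSum k (h.val / q) n : ℂ) * B n) := by
    simp_rw [← mul_assoc]
    rw [← Finset.sum_mul, sum_inv_mul_cosDivisorSum hχ he, ← hτ, hB]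
    field_simp
  have hsB := summable_sum (s := (Finset.univ : Finset (ZMod q))) fun h _ => (hterm h).1
  have hsC (h : ZMod q) : Summable fun m : ℕ+ =>
      χ⁻¹ h * ((Real.cos (2 * π * m * (h.val / q)) : ℂ) / (m : ℂ) ^ (k + 1)) := by
    refine Summable.mul_left _ (Summable.of_norm_bounded
      (summable_pnat_inv_pow_complex hk.pos).norm fun m => ?_)
    rw [div_eq_mul_inv, norm_mul, Complex.norm_real]
    exact mul_le_of_le_one_left (norm_nonneg _) (Real.abs_cos_le_one _)
  have hCsum : ∑ h, χ⁻¹ h * C h = conj τ * DirichletCharacter.LFunction χ (1 + k) := by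
    rw [LFunction_one_add_natCast χ hk.pos, ← tsum_mul_left]
    simp_rw [hC, ← tsum_mul_left]
    rw [← Summable.tsum_finsetSum fun h _ => hsC h]
    refine tsum_congr fun m => ?_
    have hdiv (h : ZMod q) : χ⁻¹ h * ((Real.cos (2 * π * m * (h.val / q)) : ℂ)
        / (m : ℂ) ^ (k + 1)) = χ⁻¹ h * (Real.cos (2 * π * m * (h.val / q)) : ℂ)
        / (m : ℂ) ^ (k + 1) := mul_div_assoc' _ _ _
    simp_rw [hdiv]
    rw [← Finset.sum_div, sum_inv_mul_cos hχ he, ← hτ]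
    ring
  -- This removes the ζ(k + 1) term, which does not depend on θ.
  have hsum1 : ∑ h, χ⁻¹ h = 0 := MulChar.sum_eq_zero_of_ne_one (inv_ne_one.2 hne)
  have hLneg : ∑ h, χ⁻¹ h * L (-h) = ∑ h, χ⁻¹ h * L h := by
    refine Fintype.sum_equiv (Equiv.neg _) _ _ fun h => ?_
    rw [Equiv.neg_apply, inv_apply_eq_conj, inv_apply_eq_conj,
      DirichletCharacter.Even.eval_neg _ _ he]
  have hLsum := sum_mul_tsum_latticeTerm hz k hν ha hx
  have hκ : 0 < 16 * π ^ 2 / (a ^ 2 * q) / x := by positivity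
  have hsig (n : ℕ+) : sigmaChi k χ⁻¹ n * (Complex.Gamma (ν + k + 1)
      / ((16 * π ^ 2 / (a ^ 2 * q) * ((n : ℝ) / x) + 1 : ℝ) : ℂ) ^ (ν + k + 1))
      = Complex.Gamma (ν + k + 1) * (sigmaChi k χ⁻¹ n
      / ((16 * π ^ 2 / (a ^ 2 * q) * ((n : ℝ) / x) + 1 : ℝ) : ℂ) ^ (ν + k + 1)) := by ring
  refine ⟨?_, ?_, ?_⟩
  · simp_rw [hcoef]
    exact hsB.mul_left _
  · simp_rw [hsig]
    refine Summable.mul_left _ ((hasSum_sigmaChi χ⁻¹ k hν hκ).summable.congr fun n => ?_)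
    congr 3
    ring
  · simp_rw [hcoef, hsig]
    change X ^ (ν / 2 + k + 1) * _ = _
    rw [tsum_mul_left, tsum_mul_left, Summable.tsum_finsetSum fun h _ => (hterm h).1,
      mul_left_comm, Finset.mul_sum]
    simp_rw [(hterm _).2]
    rw [Finset.sum_sub_distrib, Finset.sum_add_distrib, ← Finset.mul_sum, ← Finset.mul_sum,
      ← Finset.mul_sum, Finset.sum_add_distrib, hLneg, hCsum, hsum1, hLsum]
    rw [show Complex.Gamma ((k : ℂ) + 1) = k.factorial from Complex.Gamma_nat_eq_factorial k]
    have hτ0 : τ ≠ 0 := fun h => hq0 (by rw [← hττ, h, zero_mul])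
    -- The factor 1/q here and q^{-k} from the lattice sum combine into the q^{-(k+1)} of the
    -- statement.
    have hτinv : (conj τ)⁻¹ = τ / q := by rw [← hττ]; field_simp
    have hcc : (conj τ)⁻¹ * conj τ = 1 := inv_mul_cancel₀ hτc
    rw [div_pow, pow_succ (q : ℂ) k]
    generalize ∑' n : ℕ+, sigmaChi k χ⁻¹ n
      / ((16 * π ^ 2 / (a ^ 2 * q) * ((n : ℝ) / x) + 1 : ℝ) : ℂ) ^ (ν + k + 1) = S
    generalize DirichletCharacter.LFunction χ (1 + k) = Λ
    have hfin : (conj τ)⁻¹ * (c1 * (((q : ℂ) ^ k)⁻¹ * S + ((q : ℂ) ^ k)⁻¹ * S)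
        + c2 * (conj τ * Λ) - c3 * 0) = c2 * Λ + τ / q * (2 * c1 * (((q : ℂ) ^ k)⁻¹ * S)) := by
      rw [← hτinv]
      linear_combination c2 * Λ * hcc
    rw [hfin]
    simp only [c1, c2]
    field_simp
    ring

end CharacterIdentity

theorem theorem2p9 (k : ℕ) (hk : Odd k) (ν : ℂ) (hν : 0 < ν.re)
    (a x : ℝ) (ha : 0 < a) (hx : 0 < x) :
    (∀ θ : ℝ, 0 < θ → θ < 1 → CosIdentity k ν a x θ) ∧
    ((∀ θ : ℝ, 0 < θ → θ < 1 → CosIdentity k ν a x θ) ↔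
      ∀ (q : ℕ) [NeZero q] (χ : DirichletCharacter ℂ q),
        χ.IsPrimitive → χ ≠ 1 → χ.Even → CharIdentity k ν a x χ) := by
  have hcos : ∀ θ : ℝ, 0 < θ → θ < 1 → CosIdentity k ν a x θ :=
    fun θ h0 h1 => cosIdentity_of_odd hk hν ha hx h0 h1
  -- Both sides of the equivalence are true for the given parameters, which settles each
  -- implication.
  exact ⟨hcos, fun _ q _ χ hχ hne he => charIdentity_of_odd hk hν ha hx hχ hne he,
    fun _ => hcos⟩
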